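/- Let $\mathcal X\subset\mathbb R^n$ be compact and consider binary classification with label set $\mathcal C=\{0,1\}$. A domain $\mathcal D=(\mu_{\mathcal D},l_{\mathcal D})$ consists of a Borel probability measure $\mu_{\mathcal D}$ on $\mathcal X$ and a measurable labeling function $l_{\mathcal D}:\mathcal X\to\mathcal C$; the error of a hypothesis $h:\mathcal X\to\mathcal C$ on $\mathcal D$ is $\epsilon_{\mathcal D}(h)=\Pr_{x\sim\mu_{\mathcal D}}[h(x)\ne l_{\mathcal D}(x)]$. For domains $\mathcal D,\mathcal D'$ and $k\ge 1$ the $k$-th order label-wise moment divergence is $$d_{LM,k}(\mathcal D,\mathcal D')=\sum_{c\in\mathcal C}\ \sum_{\mathbf i\in\mathbb N_0^n,\ i_1+\dots+i_n=k}\Bigl|\,p(c)\int_{\mathcal X}\prod_{j=1}^n x_j^{i_j}\,d\mu_c(x)-p'(c)\int_{\mathcal X}\prod_{j=1}^n x_j^{i_j}\,d\mu'_c(x)\Bigr|,$$ where $p(c)=\mu_{\mathcal D}(l_{\mathcal D}=c)$, $\mu_c=\mu_{\mathcal D}(\,\cdot\mid l_{\mathcal D}=c)$, and $p'(c),\mu'_c$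 are the same objects for $\mathcal D'$ (a term with $p(c)=0$ or $p'(c)=0$ is read as $0$). Let $\mathcal S_1,\dots,\mathcal S_N$ (sources) and $\mathcal T$ (target) be domains over $\mathcal X$, and let $\mathcal H$ be a class of measurable hypotheses $\mathcal X\to\{0,1\}$ of finite VC dimension $d$ which satisfies the usual measurability convention that for all $k$ and all $b\in\{0,1\}^k$ the set of $(x_1,\dots,x_k)\in\mathcal X^k$ for which some $h\in\mathcal H$ has $h(x_j)=b_j$ for all $j$ is universally measurable. Let $\alpha_1,\dots,\alpha_N\ge 0$ with $\sum_i\alpha_i=1$. Let $n_{\mathcal S_1},\dots,n_{\mathcal S_N}\ge1$ be integers, $m=\sum_i n_{\mathcal S_i}$ with $d\le 2m$, and $\beta_i=n_{\mathcal S_i}/m$. Draw independent points $x^{\mathcal S_i}_j\sim\mu_{\mathcal S_i}$ ($1\le i\le N$, $1\le j\le n_{\mathcal S_i}$), with labels $y^{\mathcal S_i}_j=l_{\mathcal S_i}(x^{\mathcal S_i}_j)$, and put $$\hat\epsilon_{\alpha}(h)=\sum_{i=1}^N\alpha_i\,\frac1{n_{\mathcal S_i}}\sum_{j=1}^{n_{\mathcal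 S_i}}\mathbf 1_{h(x^{\mathcal S_i}_j)\ne y^{\mathcal S_i}_j}.$$ Let $h^*_{\mathcal T}\in\mathcal H$ minimize $\epsilon_{\mathcal T}$ over $\mathcal H$, let $\lambda_i=\inf_{h\in\mathcal H}\{\epsilon_{\mathcal T}(h)+\epsilon_{\mathcal S_i}(h)\}$, and let $$\eta_{\alpha,\beta,m,\delta}=4\sqrt{\Bigl(\sum_{i=1}^N\frac{\alpha_i^2}{\beta_i}\Bigr)\,\frac{2d\bigl(\log\frac{2m}{d}+1\bigr)+2\log\frac4\delta}{m}}$$ (for $d=0$ the term $2d(\log\frac{2m}{d}+1)$ is read as $0$). Then for every $\delta\in(0,1)$ and $\epsilon>0$ there exist nonnegative integers $n_\epsilon^1,\dots,n_\epsilon^N$ and real constants $a_{n_\epsilon^1},\dots,a_{n_\epsilon^N}$, not depending on the drawn sample, such that with probability at least $1-\delta$ over the sample every $\hat h\in\mathcal H$ that minimizes $\hat\epsilon_\alpha$ over $\mathcal H$ satisfies $$\epsilon_{\mathcal T}(\hat h)\le\epsilon_{\mathcal T}(h^*_{\mathcal T})+\eta_{\alpha,\beta,m,\delta}+\epsilon+\sum_{i=1}^N\alpha_i\Bigl(2\lambda_i+a_{n_\epsilon^i}\sum_{k=1}^{n_\epsilon^i}d_{LM,k}(\mathcal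 S_i,\mathcal T)\Bigr).$$ -/

import Mathlib

open MeasureTheory ProbabilityTheory

noncomputable section

/-- A domain over an input space `𝒳`: a data distribution together with a (binary) labeling
function. -/
structure LabeledDomain (𝒳 : Type*) [MeasurableSpace 𝒳] where
  /-- the data distribution -/
  μ : Measure 𝒳
  isProb : IsProbabilityMeasure μ
  /-- the labeling function -/
  label : 𝒳 → Bool
  measurable_label : Measurable label

namespace LabeledDomain

variable {𝒳 : Type*} [MeasurableSpace 𝒳]

/-- The error rate `Pr_{x ∼ μ} [h x ≠ label x]` of a hypothesis on a domain. -/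
def error (D : LabeledDomain 𝒳) (h : 𝒳 → Bool) : ℝ :=
  D.μ.real {x | h x ≠ D.label x}

/-- The probability `p(c)` that a data point of the domain has label `c`. -/
def labelProb (D : LabeledDomain 𝒳) (c : Bool) : ℝ :=
  D.μ.real {x | D.label x = c}

/-- The data distribution `μ_c` of the domain given that the label is `c`. -/
def condLabel (D : LabeledDomain 𝒳) (c : Bool) : Measure 𝒳 :=
  ProbabilityTheory.cond D.μ {x | D.label x = c}

end LabeledDomain

/-- The `k`-th order label-wise moment divergence of two domains over `X ⊆ ℝⁿ`. The multi-indices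
`e : Fin n → ℕ` with `∑ j, e j = k` form `Finset.piAntidiag Finset.univ k`. -/
def labelMomentDiv {n : ℕ} {X : Set (Fin n → ℝ)} (k : ℕ) (D D' : LabeledDomain X) : ℝ :=
  ∑ c : Bool, ∑ e ∈ Finset.piAntidiag (Finset.univ : Finset (Fin n)) k,
    |D.labelProb c * ∫ x : X, ∏ j, (x : Fin n → ℝ) j ^ e j ∂(D.condLabel c) -
      D'.labelProb c * ∫ x : X, ∏ j, (x : Fin n → ℝ) j ^ e j ∂(D'.condLabel c)|

/-- `H` shatters the finite set `A`: every labeling of `A` is realized by a member of `H`. -/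
def ClassShatters {𝒳 : Type*} (H : Set (𝒳 → Bool)) (A : Finset 𝒳) : Prop :=
  ∀ b : 𝒳 → Bool, ∃ h ∈ H, ∀ x ∈ A, h x = b x

/-- The VC dimension: the supremum of the cardinalities of the finite sets shattered by `H`. -/
def classVCDim {𝒳 : Type*} (H : Set (𝒳 → Bool)) : ℕ∞ :=
  ⨆ (A : Finset 𝒳) (_ : ClassShatters H A), (A.card : ℕ∞)

/-- The measurability convention on a hypothesis class that makes uniform deviations over the
(possibly uncountable) class measurable: every hypothesis is measurable and, for every labeling
pattern `b` of length `k`, the set of `k`-tuples of points on which some hypothesis realizes `b` is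
universally measurable. Every countable class of measurable hypotheses has this property. -/
structure IsMeasurableClass {𝒳 : Type*} [MeasurableSpace 𝒳] (H : Set (𝒳 → Bool)) : Prop where
  measurable : ∀ h ∈ H, Measurable h
  trace : ∀ (k : ℕ) (b : Fin k → Bool) (ν : Measure (Fin k → 𝒳)), IsProbabilityMeasure ν →
    NullMeasurableSet {x : Fin k → 𝒳 | ∃ h ∈ H, ∀ j, h (x j) = b j} ν

section Samples

variable {𝒳 : Type*} [MeasurableSpace 𝒳] {N : ℕ}

/-- The input points of `N` datasets, the `i`-th one of size `nS i`. The point `s ⟨i, j⟩` has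
the label `(S i).label (s ⟨i, j⟩)`. -/
abbrev SourceSample (𝒳 : Type*) {N : ℕ} (nS : Fin N → ℕ) : Type _ :=
  ((i : Fin N) × Fin (nS i)) → 𝒳

/-- The law of the datasets: all points are independent and those of the `i`-th dataset are drawn
from the data distribution of the `i`-th source domain. -/
def sampleLaw (S : Fin N → LabeledDomain 𝒳) (nS : Fin N → ℕ) : Measure (SourceSample 𝒳 nS) :=
  haveI := fun i => (S i).isProb
  Measure.pi fun q : (i : Fin N) × Fin (nS i) => (S q.1).μ

/-- The empirical error of `h` on the `i`-th dataset. -/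
def empError (S : Fin N → LabeledDomain 𝒳) (nS : Fin N → ℕ) (s : SourceSample 𝒳 nS) (i : Fin N)
    (h : 𝒳 → Bool) : ℝ :=
  1 / (nS i : ℝ) * ∑ j : Fin (nS i), if h (s ⟨i, j⟩) ≠ (S i).label (s ⟨i, j⟩) then (1 : ℝ) else 0

/-- The `α`-weighted empirical source error. -/
def weightedEmpError (S : Fin N → LabeledDomain 𝒳) (nS : Fin N → ℕ) (α : Fin N → ℝ)
    (s : SourceSample 𝒳 nS) (h : 𝒳 → Bool) : ℝ :=
  ∑ i, α i * empError S nS s i h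

/-- `h` minimizes the `α`-weighted empirical source error over `H`. -/
def IsEmpMinimizer (S : Fin N → LabeledDomain 𝒳) (nS : Fin N → ℕ) (α : Fin N → ℝ)
    (H : Set (𝒳 → Bool)) (s : SourceSample 𝒳 nS) (h : 𝒳 → Bool) : Prop :=
  h ∈ H ∧ ∀ h' ∈ H, weightedEmpError S nS α s h ≤ weightedEmpError S nS α s h'

end Samples

/-- The best joint error `λ` of a source domain and a target domain over the class `H`. -/
def jointError {𝒳 : Type*} [MeasurableSpace 𝒳] (H : Set (𝒳 → Bool)) (S T : LabeledDomain 𝒳) : ℝ :=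
  ⨅ h : H, (T.error h + S.error h)

/-- The deviation term `η_{α,β,m,δ}` for a class of VC dimension `d`. -/
def deviationTerm {N : ℕ} (d : ℕ) (α β : Fin N → ℝ) (m : ℕ) (δ : ℝ) : ℝ :=
  4 * Real.sqrt ((∑ i, α i ^ 2 / β i) *
    ((2 * d * (Real.log (2 * m / d) + 1) + 2 * Real.log (4 / δ)) / m))

end

/-!
A hypothesis minimizing the weighted empirical source error has a target error exceeding that of any
competitor by at most two kinds of terms: the deviations of the empirical error from the weighted
source error, and the differences between source and target errors.

The deviations are controlled by symmetrization: the sample points are independent with losses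
`α i / nS i`, so exchanging them with a ghost sample gives a sub-Gaussian sum with variance proxy of
order `∑ i, α i ^ 2 / nS i`, for each of the `exp (d * (log (2 * m / d) + 1))` labelings.

The error of `h` on a domain is an integral, for each label `c`, of an indicator function against
the data with label `c`. A polynomial approximating this indicator in `L¹` turns the difference of
two errors into moments. Since a class of finite VC dimension is totally bounded in `L¹`, one bound
on degrees and coefficients serves for all `h`. The constant term is missing from the divergence, so
the approximation is only possible away from the origin. At the origin, either the two labels agree
and only the difference of the masses counts, which is again a matter of moments because the total
masses are equal, or they differ and every hypothesis errs there on one of the domains, so that the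
joint error absorbs the smaller mass.
-/

/-! ### Traces on finitely many points -/

section Trace

variable {𝒳 κ : Type*} [Fintype κ] {H : Set (𝒳 → Bool)} {d : ℕ}

open Classical in
/-- The trace of the class `H` on the points `x j`: the labelings of these points by members of `H`.
The points are a family, so they may repeat. -/
noncomputable def classTrace (H : Set (𝒳 → Bool)) (x : κ → 𝒳) : Finset (κ → Bool) :=
  Finset.univ.filter fun b => ∃ h ∈ H, ∀ j, h (x j) = b j

lemma mem_classTrace {x : κ → 𝒳} {b : κ → Bool} :
    b ∈ classTrace H x ↔ ∃ h ∈ H, ∀ j, h (x j) = b j := by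
  simp [classTrace]

lemma comp_mem_classTrace {h : 𝒳 → Bool} (hh : h ∈ H) (x : κ → 𝒳) : h ∘ x ∈ classTrace H x :=
  mem_classTrace.2 ⟨h, hh, fun _ => rfl⟩

lemma ClassShatters.card_le {A : Finset 𝒳} (hA : ClassShatters H A) (hd : classVCDim H ≤ d) :
    A.card ≤ d := by
  have h : (A.card : ℕ∞) ≤ classVCDim H := le_iSup₂_of_le A hA le_rfl
  exact_mod_cast h.trans hd

lemma exists_eqOn_of_shatters_classTrace [DecidableEq κ] {x : κ → 𝒳} {A : Finset κ}
    (hA : ((classTrace H x).image fun b => Finset.univ.filter (b · = true)).Shatters A)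
    (b : κ → Bool) : ∃ h ∈ H, ∀ j ∈ A, h (x j) = b j := by
  obtain ⟨u, hu, hAu⟩ := hA (Finset.filter_subset (b · = true) A)
  obtain ⟨b', hb', rfl⟩ := Finset.mem_image.1 hu
  obtain ⟨h, hh, hhb'⟩ := mem_classTrace.1 hb'
  refine ⟨h, hh, fun j hj => ?_⟩
  have hj' := Finset.ext_iff.1 hAu j
  rw [hhb', Bool.eq_iff_iff]
  simpa [hj] using hj'

lemma injOn_of_shatters_classTrace [DecidableEq κ] {x : κ → 𝒳} {A : Finset κ}
    (hA : ((classTrace H x).image fun b => Finset.univ.filter (b · = true)).Shatters A) :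
    Set.InjOn x A := by
  intro i hi j hj hij
  obtain ⟨h, -, hh⟩ := exists_eqOn_of_shatters_classTrace hA fun k => decide (k = i)
  have h_eq : decide (i = i) = decide (j = i) := by rw [← hh i hi, ← hh j hj, hij]
  simpa [eq_comm] using h_eq

lemma card_le_of_shatters_classTrace [DecidableEq κ] (hd : classVCDim H ≤ d) {x : κ → 𝒳}
    {A : Finset κ}
    (hA : ((classTrace H x).image fun b => Finset.univ.filter (b · = true)).Shatters A) :
    A.card ≤ d := by
  classical
  rw [← Finset.card_image_of_injOn (injOn_of_shatters_classTrace hA)]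
  refine ClassShatters.card_le (fun b => ?_) hd
  simpa using exists_eqOn_of_shatters_classTrace hA (b ∘ x)

/-- **Sauer–Shelah lemma**. -/
theorem card_classTrace_le_sum_choose (hd : classVCDim H ≤ d) (x : κ → 𝒳) :
    (classTrace H x).card ≤ ∑ k ∈ Finset.range (d + 1), (Fintype.card κ).choose k := by
  classical
  set 𝒜 := (classTrace H x).image fun b => Finset.univ.filter (b · = true)
  have hinj : Function.Injective fun b : κ → Bool => Finset.univ.filter (b · = true) := by
    intro b b' hbb'
    ext j
    simpa using Finset.ext_iff.1 hbb' j
  have hvc : 𝒜.vcDim ≤ d :=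
    Finset.sup_le fun A hA => card_le_of_shatters_classTrace hd (Finset.mem_shatterer.1 hA)
  calc (classTrace H x).card = 𝒜.card := (Finset.card_image_of_injective _ hinj).symm
    _ ≤ 𝒜.shatterer.card := Finset.card_le_card_shatterer 𝒜
    _ ≤ ∑ k ∈ Finset.Iic 𝒜.vcDim, (Fintype.card κ).choose k :=
      Finset.card_shatterer_le_sum_vcDim
    _ ≤ _ := Finset.sum_le_sum_of_subset fun k hk =>
      Finset.mem_range_succ_iff.2 ((Finset.mem_Iic.1 hk).trans hvc)

end Trace

lemma pow_mul_sum_choose_le_one_add_pow {r : ℝ} (hr : 0 ≤ r) (hr1 : r ≤ 1) {M d : ℕ} (h : d ≤ M) :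
    r ^ d * ∑ k ∈ Finset.range (d + 1), (M.choose k : ℝ) ≤ (1 + r) ^ M := by
  calc r ^ d * ∑ k ∈ Finset.range (d + 1), (M.choose k : ℝ)
      = ∑ k ∈ Finset.range (d + 1), r ^ d * (M.choose k : ℝ) := Finset.mul_sum ..
    _ ≤ ∑ k ∈ Finset.range (d + 1), r ^ k * (M.choose k : ℝ) := by
        refine Finset.sum_le_sum fun k hk => mul_le_mul_of_nonneg_right ?_ (by positivity)
        exact pow_le_pow_of_le_one hr hr1 (Finset.mem_range_succ_iff.1 hk)
    _ ≤ ∑ k ∈ Finset.range (M + 1), r ^ k * (M.choose k : ℝ) := by gcongr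
    _ = (1 + r) ^ M := by simp [add_comm 1 r, add_pow]

lemma sum_range_choose_le_exp {M d : ℕ} (h : d ≤ M) :
    ∑ k ∈ Finset.range (d + 1), (M.choose k : ℝ) ≤ Real.exp (d * (Real.log (M / d) + 1)) := by
  rcases d.eq_zero_or_pos with rfl | hd
  · simp
  have : (0 : ℝ) < d := by exact_mod_cast hd
  have hM : (0 : ℝ) < M := by exact_mod_cast hd.trans_le h
  have hdM : (d / M : ℝ) ≤ 1 := by rw [div_le_one hM]; exact_mod_cast h
  rw [← mul_le_mul_iff_right₀ (show 0 < (d / M : ℝ) ^ d by positivity)]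
  calc (d / M : ℝ) ^ d * ∑ k ∈ Finset.range (d + 1), (M.choose k : ℝ)
      ≤ (1 + d / M) ^ M := pow_mul_sum_choose_le_one_add_pow (by positivity) hdM h
    _ ≤ Real.exp (d / M) ^ M := by gcongr; linarith [Real.add_one_le_exp (d / M : ℝ)]
    _ = Real.exp d := by rw [← Real.exp_nat_mul]; congr 1; field_simp
    _ = (d / M : ℝ) ^ d * Real.exp (d * (Real.log (M / d) + 1)) := by
        have hlog : (d / M : ℝ) ^ d = Real.exp (d * -Real.log (M / d)) := by
          rw [Real.exp_nat_mul, ← Real.log_inv, inv_div, Real.exp_log (by positivity)]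
        rw [hlog, ← Real.exp_add]
        ring_nf

lemma sum_range_choose_le_pow (M d : ℕ) :
    ∑ k ∈ Finset.range (d + 1), M.choose k ≤ (M + 1) ^ d := by
  rw [add_pow]
  refine Finset.sum_le_sum fun k hk => ?_
  rw [one_pow, mul_one]
  exact (Nat.choose_le_pow M k).trans
    (Nat.le_mul_of_pos_right _ (Nat.choose_pos (Finset.mem_range_succ_iff.1 hk)))

/-! ### Sums with random signs -/

section Signs

variable {ι : Type*} [Fintype ι] [DecidableEq ι]

lemma sum_exp_signed_sum (c : ι → ℝ) :
    ∑ σ : ι → Bool, Real.exp (∑ q, if σ q then -c q else c q) = ∏ q, (2 * Real.cosh (c q)) := by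
  have h_cosh : ∀ q, 2 * Real.cosh (c q) = ∑ b : Bool, Real.exp (if b then -c q else c q) := by
    intro q
    rw [Real.cosh_eq, Fintype.sum_bool]
    simp only [if_true, Bool.false_eq_true, if_false]
    ring
  simp_rw [Real.exp_sum, h_cosh]
  exact (Fintype.prod_sum fun q (b : Bool) => Real.exp (if b then -c q else c q)).symm

lemma sum_exp_signed_sum_le (c : ι → ℝ) :
    ∑ σ : ι → Bool, Real.exp (∑ q, if σ q then -c q else c q) ≤
      2 ^ Fintype.card ι * Real.exp ((∑ q, c q ^ 2) / 2) := by
  calc ∑ σ : ι → Bool, Real.exp (∑ q, if σ q then -c q else c q)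
      = ∏ q, (2 * Real.cosh (c q)) := sum_exp_signed_sum c
    _ ≤ ∏ q, (2 * Real.exp (c q ^ 2 / 2)) :=
        Finset.prod_le_prod (fun q _ => by positivity)
          fun q _ => by gcongr; exact Real.cosh_le_exp_half_sq _
    _ = 2 ^ Fintype.card ι * Real.exp ((∑ q, c q ^ 2) / 2) := by
        rw [Finset.prod_mul_distrib, ← Real.exp_sum, Finset.prod_const, Finset.card_univ,
          Finset.sum_div]

/-- Chernoff's method, with the parameter `r = u / W`. -/
lemma card_signed_sum_gt_le (c : ι → ℝ) {u W : ℝ} (hu : 0 ≤ u) (hW : 0 < W)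
    (hc : ∑ q, c q ^ 2 ≤ W) :
    ((Finset.univ.filter fun σ : ι → Bool => u < ∑ q, if σ q then -c q else c q).card : ℝ) ≤
      2 ^ Fintype.card ι * Real.exp (-u ^ 2 / (2 * W)) := by
  set r : ℝ := u / W with hr_def
  have hr : 0 ≤ r := by positivity
  set F := Finset.univ.filter fun σ : ι → Bool => u < ∑ q, if σ q then -c q else c q
  have h_sum : F.card * Real.exp (r * u) ≤ 2 ^ Fintype.card ι * Real.exp (r ^ 2 * W / 2) := by
    calc F.card * Real.exp (r * u)
        = ∑ _σ ∈ F, Real.exp (r * u) := by rw [Finset.sum_const, nsmul_eq_mul]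
      _ ≤ ∑ σ ∈ F, Real.exp (∑ q, if σ q then -(r * c q) else r * c q) := by
          refine Finset.sum_le_sum fun σ hσ => Real.exp_le_exp.2 ?_
          have h_mul : r * ∑ q, (if σ q then -c q else c q) =
              ∑ q, if σ q then -(r * c q) else r * c q := by
            simp only [Finset.mul_sum, mul_ite, mul_neg]
          exact h_mul ▸ mul_le_mul_of_nonneg_left (Finset.mem_filter.1 hσ).2.le hr
      _ ≤ ∑ σ : ι → Bool, Real.exp (∑ q, if σ q then -(r * c q) else r * c q) :=
          Finset.sum_le_sum_of_subset_of_nonneg (Finset.subset_univ _) fun _ _ _ => by positivity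
      _ ≤ 2 ^ Fintype.card ι * Real.exp ((∑ q, (r * c q) ^ 2) / 2) := sum_exp_signed_sum_le _
      _ ≤ 2 ^ Fintype.card ι * Real.exp (r ^ 2 * W / 2) := by
          simp only [mul_pow, ← Finset.mul_sum]
          gcongr
  have h_exponent : -u ^ 2 / (2 * W) = r ^ 2 * W / 2 - r * u := by
    rw [hr_def]; field_simp; ring
  rwa [h_exponent, Real.exp_sub, ← mul_div_assoc, le_div_iff₀ (Real.exp_pos _)]

end Signs

/-! ### Hoeffding's inequality on a product space -/

section Hoeffding

variable {ι : Type*} [Fintype ι] {Ω : ι → Type*} [∀ q, MeasurableSpace (Ω q)]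
  (μ : ∀ q, Measure (Ω q)) [∀ q, IsProbabilityMeasure (μ q)] {f : ∀ q, Ω q → ℝ} {a b : ι → ℝ}

lemma hasSubgaussianMGF_pi_eval (hf : ∀ q, Measurable (f q))
    (hab : ∀ q x, f q x ∈ Set.Icc (a q) (b q)) (q : ι) :
    HasSubgaussianMGF (fun s : ∀ q, Ω q => f q (s q) - ∫ x, f q x ∂μ q)
      ((‖b q - a q‖₊ / 2) ^ 2) (Measure.pi μ) := by
  have h_eval := measurePreserving_eval μ q
  have h := hasSubgaussianMGF_of_mem_Icc (μ := μ q) (hf q).aemeasurable (ae_of_all _ (hab q))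
  rw [← h_eval.map_eq] at h
  have h' := h.of_map h_eval.aemeasurable
  rwa [h_eval.map_eq] at h'

theorem measureReal_pi_sum_sub_integral_ge_le (hf : ∀ q, Measurable (f q))
    (hab : ∀ q x, f q x ∈ Set.Icc (a q) (b q)) {u : ℝ} (hu : 0 ≤ u) :
    (Measure.pi μ).real {s | u ≤ ∑ q, (f q (s q) - ∫ x, f q x ∂μ q)} ≤
      Real.exp (-(2 * u ^ 2) / ∑ q, (b q - a q) ^ 2) := by
  have h_indep : iIndepFun (fun q (s : ∀ q, Ω q) => f q (s q) - ∫ x, f q x ∂μ q)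
      (Measure.pi μ) :=
    iIndepFun_pi (X := fun q x => f q x - ∫ x, f q x ∂μ q)
      fun q => ((hf q).sub_const _).aemeasurable
  have h_tail := HasSubgaussianMGF.measure_sum_ge_le_of_iIndepFun h_indep (s := Finset.univ)
    (fun q _ => hasSubgaussianMGF_pi_eval μ hf hab q) hu
  refine h_tail.trans_eq (congrArg Real.exp ?_)
  push_cast
  simp only [Real.norm_eq_abs, div_pow, sq_abs, ← Finset.sum_div]
  rcases eq_or_ne (∑ q, (b q - a q) ^ 2) 0 with h0 | h0
  · simp [h0]
  · field_simp

theorem measureReal_pi_sum_integral_sub_ge_le (hf : ∀ q, Measurable (f q))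
    (hab : ∀ q x, f q x ∈ Set.Icc (a q) (b q)) {u : ℝ} (hu : 0 ≤ u) :
    (Measure.pi μ).real {s | u ≤ ∑ q, ((∫ x, f q x ∂μ q) - f q (s q))} ≤
      Real.exp (-(2 * u ^ 2) / ∑ q, (b q - a q) ^ 2) := by
  have h_neg : ∀ q x, -f q x ∈ Set.Icc (-b q) (-a q) := fun q x =>
    ⟨neg_le_neg (hab q x).2, neg_le_neg (hab q x).1⟩
  have h := measureReal_pi_sum_sub_integral_ge_le μ (f := fun q x => -f q x)
    (fun q => (hf q).neg) h_neg hu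
  simpa only [integral_neg, neg_sub_neg, neg_sub] using h

end Hoeffding

/-! ### The Vapnik–Chervonenkis inequality -/

lemma mul_measure_le_prod {Ω Ω' : Type*} [MeasurableSpace Ω] [MeasurableSpace Ω'] {P : Measure Ω}
    {Q : Measure Ω'} [SFinite Q] {A : Set Ω} {C : Set (Ω × Ω')} {c : ENNReal}
    (h : ∀ x ∈ A, c ≤ Q (Prod.mk x ⁻¹' C)) : c * P A ≤ P.prod Q C := by
  set C' := toMeasurable (P.prod Q) C
  have hC' : MeasurableSet C' := measurableSet_toMeasurable _ _
  calc c * P A ≤ c * P {x | c ≤ Q (Prod.mk x ⁻¹' C')} := by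
        gcongr
        exact fun x hx => (h x hx).trans (measure_mono fun y hy => subset_toMeasurable _ _ hy)
    _ ≤ ∫⁻ x, Q (Prod.mk x ⁻¹' C') ∂P :=
        mul_meas_ge_le_lintegral (measurable_measure_prodMk_left hC') c
    _ = P.prod Q C' := (Measure.prod_apply hC').symm
    _ = P.prod Q C := measure_toMeasurable C

section Deviation

variable {𝒳 ι : Type*}

/-- All the points of a double sample, on which the labelings by the class are counted. -/
def pairPoints (z : ι → 𝒳 × 𝒳) : ι ⊕ ι → 𝒳 :=
  Sum.elim (fun q => (z q).1) fun q => (z q).2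

/-- Exchange the two points of the pairs selected by `σ`, the symmetry of the law of a double
sample on which the symmetrization argument rests. -/
def swapPairs (σ : ι → Bool) (z : ι → 𝒳 × 𝒳) : ι → 𝒳 × 𝒳 :=
  fun q => if σ q then (z q).swap else z q

/-- The increment of the loss `φ q` over the `q`-th pair of a double sample whose points are
labeled by `b`. -/
def pairGap (φ : ι → 𝒳 × Bool → ℝ) (z : ι → 𝒳 × 𝒳) (b : ι ⊕ ι → Bool) (q : ι) : ℝ :=
  φ q ((z q).2, b (.inr q)) - φ q ((z q).1, b (.inl q))

lemma pairGap_sq_le {φ : ι → 𝒳 × Bool → ℝ} {a b : ι → ℝ} (hφ : ∀ q p, φ q p ∈ Set.Icc (a q) (b q))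
    (z : ι → 𝒳 × 𝒳) (c : ι ⊕ ι → Bool) (q : ι) : pairGap φ z c q ^ 2 ≤ (b q - a q) ^ 2 := by
  have h₁ := hφ q ((z q).1, c (.inl q))
  have h₂ := hφ q ((z q).2, c (.inr q))
  rw [sq_le_sq, pairGap]
  exact (abs_sub_le_of_le_of_le h₂.1 h₂.2 h₁.1 h₁.2).trans (le_abs_self _)

lemma pairGap_swapPairs (φ : ι → 𝒳 × Bool → ℝ) (σ : ι → Bool) (z : ι → 𝒳 × 𝒳) (h : 𝒳 → Bool)
    (q : ι) : pairGap φ (swapPairs σ z) (h ∘ pairPoints (swapPairs σ z)) q =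
      if σ q then -pairGap φ z (h ∘ pairPoints z) q else pairGap φ z (h ∘ pairPoints z) q := by
  by_cases hq : σ q <;> simp [pairGap, pairPoints, swapPairs, hq]

lemma measurable_pairPoints [MeasurableSpace 𝒳] :
    Measurable (pairPoints : (ι → 𝒳 × 𝒳) → ι ⊕ ι → 𝒳) := by
  refine measurable_pi_lambda _ (Sum.rec (fun q => ?_) fun q => ?_)
  · exact measurable_fst.comp (measurable_pi_apply q)
  · exact measurable_snd.comp (measurable_pi_apply q)

lemma measurable_pairGap [MeasurableSpace 𝒳] {φ : ι → 𝒳 × Bool → ℝ}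
    (hφ : ∀ q, Measurable (φ q)) (b : ι ⊕ ι → Bool) (q : ι) :
    Measurable fun z => pairGap φ z b q := by
  have := hφ q
  unfold pairGap
  fun_prop

variable [Fintype ι]

/-- The total loss of the hypothesis `h` on the sample `s`, where the loss `φ q` of the `q`-th
point depends on the point and on its label. Weights are absorbed into `φ`. -/
def empLoss (φ : ι → 𝒳 × Bool → ℝ) (s : ι → 𝒳) (h : 𝒳 → Bool) : ℝ :=
  ∑ q, φ q (s q, h (s q))

/-- The double samples on which the loss of some hypothesis grows by more than `u` from the first
half to the second (ghost) half. -/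
def ghostEvent (H : Set (𝒳 → Bool)) (φ : ι → 𝒳 × Bool → ℝ) (u : ℝ) : Set (ι → 𝒳 × 𝒳) :=
  {z | ∃ h ∈ H, u < empLoss φ (fun q => (z q).2) h - empLoss φ (fun q => (z q).1) h}

lemma empLoss_sub_empLoss_eq_sum_pairGap (φ : ι → 𝒳 × Bool → ℝ) (z : ι → 𝒳 × 𝒳) (h : 𝒳 → Bool) :
    empLoss φ (fun q => (z q).2) h - empLoss φ (fun q => (z q).1) h =
      ∑ q, pairGap φ z (h ∘ pairPoints z) q :=
  (Finset.sum_sub_distrib ..).symm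

open Classical in
lemma card_swapPairs_mem_ghostEvent_le (H : Set (𝒳 → Bool)) {φ : ι → 𝒳 × Bool → ℝ} {a b : ι → ℝ}
    (hφ : ∀ q p, φ q p ∈ Set.Icc (a q) (b q)) (hab : 0 < ∑ q, (b q - a q) ^ 2) {u : ℝ}
    (hu : 0 ≤ u) (z : ι → 𝒳 × 𝒳) :
    ((Finset.univ.filter fun σ : ι → Bool => swapPairs σ z ∈ ghostEvent H φ u).card : ℝ) ≤
      (classTrace H (pairPoints z)).card *
        (2 ^ Fintype.card ι * Real.exp (-u ^ 2 / (2 * ∑ q, (b q - a q) ^ 2))) := by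
  let F : (ι ⊕ ι → Bool) → Finset (ι → Bool) := fun c =>
    Finset.univ.filter fun σ => u < ∑ q, if σ q then -pairGap φ z c q else pairGap φ z c q
  have hsub : (Finset.univ.filter fun σ : ι → Bool => swapPairs σ z ∈ ghostEvent H φ u) ⊆
      (classTrace H (pairPoints z)).biUnion F := by
    intro σ hσ
    obtain ⟨h, hh, hu⟩ := (Finset.mem_filter.1 hσ).2
    simp only [empLoss_sub_empLoss_eq_sum_pairGap, pairGap_swapPairs] at hu
    exact Finset.mem_biUnion.2 ⟨h ∘ pairPoints z, comp_mem_classTrace hh _,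
      Finset.mem_filter.2 ⟨Finset.mem_univ _, hu⟩⟩
  have hF : ∀ c, ((F c).card : ℝ) ≤
      2 ^ Fintype.card ι * Real.exp (-u ^ 2 / (2 * ∑ q, (b q - a q) ^ 2)) := fun c =>
    card_signed_sum_gt_le _ hu hab (Finset.sum_le_sum fun q _ => pairGap_sq_le hφ z c q)
  calc _ ≤ (((classTrace H (pairPoints z)).biUnion F).card : ℝ) := by
        exact_mod_cast Finset.card_le_card hsub
    _ ≤ ∑ c ∈ classTrace H (pairPoints z), ((F c).card : ℝ) := by
        exact_mod_cast Finset.card_biUnion_le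
    _ ≤ _ := (Finset.sum_le_card_nsmul _ _ _ fun c _ => hF c).trans_eq (nsmul_eq_mul _ _)

variable [MeasurableSpace 𝒳]

/-- The expectation of `empLoss` when the `q`-th point has the law `μ q`. -/
noncomputable def expLoss (μ : ι → Measure 𝒳) (φ : ι → 𝒳 × Bool → ℝ) (h : 𝒳 → Bool) : ℝ :=
  ∑ q, ∫ x, φ q (x, h x) ∂μ q

lemma measurable_empLoss {φ : ι → 𝒳 × Bool → ℝ} (hφ : ∀ q, Measurable (φ q)) {h : 𝒳 → Bool}
    (hh : Measurable h) : Measurable fun s => empLoss φ s h := by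
  unfold empLoss
  fun_prop

lemma IsMeasurableClass.nullMeasurableSet_trace {H : Set (𝒳 → Bool)} (hH : IsMeasurableClass H)
    {Ω : Type*} [MeasurableSpace Ω] (P : Measure Ω) [IsProbabilityMeasure P] {κ : Type*}
    [Fintype κ] {x : Ω → κ → 𝒳} (hx : Measurable x) (b : κ → Bool) :
    NullMeasurableSet {ω | b ∈ classTrace H (x ω)} P := by
  let e := Fintype.equivFin κ
  let Φ : Ω → Fin (Fintype.card κ) → 𝒳 := fun ω j => x ω (e.symm j)
  have hΦ : Measurable Φ := measurable_pi_lambda _ fun j => (measurable_pi_apply _).comp hx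
  have h_trace := hH.trace _ (b ∘ e.symm) (P.map Φ)
    (Measure.isProbabilityMeasure_map hΦ.aemeasurable)
  convert h_trace.preimage (hΦ.measurePreserving P).quasiMeasurePreserving using 1
  ext ω
  simp [mem_classTrace, Φ, e.symm.forall_congr_left]

lemma nullMeasurableSet_ghostEvent {H : Set (𝒳 → Bool)} (hH : IsMeasurableClass H)
    (P : Measure (ι → 𝒳 × 𝒳)) [IsProbabilityMeasure P] {φ : ι → 𝒳 × Bool → ℝ}
    (hφ : ∀ q, Measurable (φ q)) (u : ℝ) : NullMeasurableSet (ghostEvent H φ u) P := by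
  have h_union : ghostEvent H φ u = ⋃ b : ι ⊕ ι → Bool,
      {z | b ∈ classTrace H (pairPoints z)} ∩ {z | u < ∑ q, pairGap φ z b q} := by
    ext z
    simp only [ghostEvent, empLoss_sub_empLoss_eq_sum_pairGap, Set.mem_ofPred_eq, Set.mem_iUnion,
      Set.mem_inter_iff]
    constructor
    · rintro ⟨h, hh, hu⟩
      exact ⟨h ∘ pairPoints z, comp_mem_classTrace hh _, hu⟩
    · rintro ⟨b, hb, hu⟩
      obtain ⟨h, hh, hhb⟩ := mem_classTrace.1 hb
      exact ⟨h, hh, by rwa [show h ∘ pairPoints z = b from funext hhb]⟩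
  rw [h_union]
  exact NullMeasurableSet.iUnion fun b =>
    (hH.nullMeasurableSet_trace P measurable_pairPoints b).inter
      (measurableSet_lt measurable_const
        (Finset.measurable_sum _ fun q _ => measurable_pairGap hφ b q)).nullMeasurableSet

lemma measurePreserving_swapPairs (μ : ι → Measure 𝒳) [∀ q, SigmaFinite (μ q)] (σ : ι → Bool) :
    MeasurePreserving (swapPairs σ) (Measure.pi fun q => (μ q).prod (μ q))
      (Measure.pi fun q => (μ q).prod (μ q)) := by
  refine measurePreserving_pi (fun q => (μ q).prod (μ q)) (fun q => (μ q).prod (μ q))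
    (f := fun q p => if σ q then p.swap else p) fun q => ?_
  by_cases h : σ q
  · simpa only [h, if_true] using Measure.measurePreserving_swap (μ := μ q) (ν := μ q)
  · simpa only [h] using! MeasurePreserving.id _

variable (μ : ι → Measure 𝒳) [∀ q, IsProbabilityMeasure (μ q)] {H : Set (𝒳 → Bool)}
  {φ : ι → 𝒳 × Bool → ℝ} {a b : ι → ℝ}

/-- The law of the double sample is invariant under all exchanges, so the probability is the mean
over the double samples of the proportion of exchanges that lead into the event. -/
theorem measure_ghostEvent_le (hH : IsMeasurableClass H) {K : ℕ}
    (hK : ∀ x : ι ⊕ ι → 𝒳, (classTrace H x).card ≤ K) (hφ : ∀ q, Measurable (φ q))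
    (hφab : ∀ q p, φ q p ∈ Set.Icc (a q) (b q)) (hab : 0 < ∑ q, (b q - a q) ^ 2) {u : ℝ}
    (hu : 0 ≤ u) :
    Measure.pi (fun q => (μ q).prod (μ q)) (ghostEvent H φ u) ≤
      ENNReal.ofReal (K * Real.exp (-u ^ 2 / (2 * ∑ q, (b q - a q) ^ 2))) := by
  classical
  set Q := Measure.pi fun q => (μ q).prod (μ q)
  set C := ghostEvent H φ u
  set B := Real.exp (-u ^ 2 / (2 * ∑ q, (b q - a q) ^ 2))
  have hC : NullMeasurableSet C Q := nullMeasurableSet_ghostEvent hH Q hφ u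
  have hσC : ∀ σ, NullMeasurableSet (swapPairs σ ⁻¹' C) Q := fun σ =>
    hC.preimage (measurePreserving_swapPairs μ σ).quasiMeasurePreserving
  have hQσ : ∀ σ, Q (swapPairs σ ⁻¹' C) = Q C := fun σ =>
    (measurePreserving_swapPairs μ σ).measure_preimage hC
  refine (ENNReal.mul_le_mul_iff_right (a := 2 ^ Fintype.card ι) (by simp) (by simp)).1 ?_
  calc (2 ^ Fintype.card ι : ENNReal) * Q C
      = ∑ σ : ι → Bool, Q (swapPairs σ ⁻¹' C) := by simp [hQσ]
    _ = ∑ σ : ι → Bool, ∫⁻ z, (swapPairs σ ⁻¹' C).indicator 1 z ∂Q :=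
        Finset.sum_congr rfl fun σ _ => (lintegral_indicator_one₀ (hσC σ)).symm
    _ = ∫⁻ z, ∑ σ : ι → Bool, (swapPairs σ ⁻¹' C).indicator 1 z ∂Q :=
        (lintegral_finsetSum' _ fun σ _ =>
          (aemeasurable_indicator_const_iff (1 : ENNReal)).2 (hσC σ)).symm
    _ ≤ ∫⁻ _, ENNReal.ofReal (K * (2 ^ Fintype.card ι * B)) ∂Q := by
        refine lintegral_mono fun z => ?_
        have h_card := card_swapPairs_mem_ghostEvent_le H hφab hab hu z
        have hKz : ((classTrace H (pairPoints z)).card : ℝ) ≤ K := by exact_mod_cast hK _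
        refine le_of_eq_of_le ?_ (ENNReal.ofReal_le_ofReal
          (h_card.trans (mul_le_mul_of_nonneg_right hKz (by positivity))))
        simp [Set.indicator_apply, C]
    _ = 2 ^ Fintype.card ι * ENNReal.ofReal (K * B) := by
        rw [lintegral_const, measure_univ, mul_one, mul_left_comm,
          ENNReal.ofReal_mul (by positivity), ENNReal.ofReal_pow (by norm_num),
          ENNReal.ofReal_ofNat]

lemma half_le_measure_expLoss_sub_empLoss_lt (hφ : ∀ q, Measurable (φ q))
    (hφab : ∀ q p, φ q p ∈ Set.Icc (a q) (b q)) (hab : 0 < ∑ q, (b q - a q) ^ 2)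
    {h : 𝒳 → Bool} (hh : Measurable h) {u : ℝ} (hu : 0 ≤ u)
    (hu' : ∑ q, (b q - a q) ^ 2 ≤ 2 * u ^ 2) :
    2⁻¹ ≤ Measure.pi μ {s | expLoss μ φ h - empLoss φ s h < u} := by
  set A := {s : ι → 𝒳 | expLoss μ φ h - empLoss φ s h < u}
  have hA : MeasurableSet A :=
    measurableSet_lt (measurable_const.sub (measurable_empLoss hφ hh)) measurable_const
  have hAc : Aᶜ = {s | u ≤ ∑ q, ((∫ x, φ q (x, h x) ∂μ q) - φ q (s q, h (s q)))} := by
    ext s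
    simp [A, expLoss, empLoss]
  have h_tail : (Measure.pi μ).real Aᶜ ≤ 2⁻¹ := by
    calc (Measure.pi μ).real Aᶜ ≤ Real.exp (-(2 * u ^ 2) / ∑ q, (b q - a q) ^ 2) := by
          rw [hAc]
          exact measureReal_pi_sum_integral_sub_ge_le μ (f := fun q x => φ q (x, h x))
            (fun q => (hφ q).comp (measurable_id.prodMk hh)) (fun q x => hφab q _) hu
      _ ≤ Real.exp (-1) := by
          gcongr
          rw [div_le_iff₀ hab]
          linarith
      _ ≤ 2⁻¹ := by
          rw [Real.exp_neg]
          exact inv_anti₀ two_pos Real.exp_one_gt_two.le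
  rw [probReal_compl_eq_one_sub hA] at h_tail
  calc (2⁻¹ : ENNReal) = ENNReal.ofReal 2⁻¹ := by
        rw [ENNReal.ofReal_inv_of_pos two_pos, ENNReal.ofReal_ofNat]
    _ ≤ ENNReal.ofReal ((Measure.pi μ).real A) := ENNReal.ofReal_le_ofReal (by linarith)
    _ = Measure.pi μ A := ofReal_measureReal

theorem measure_exists_expLoss_sub_empLoss_gt_le_ghostEvent (hH : ∀ h ∈ H, Measurable h)
    (hφ : ∀ q, Measurable (φ q)) (hφab : ∀ q p, φ q p ∈ Set.Icc (a q) (b q))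
    (hab : 0 < ∑ q, (b q - a q) ^ 2) {u : ℝ} (hu : 0 ≤ u)
    (hu' : ∑ q, (b q - a q) ^ 2 ≤ 2 * u ^ 2) :
    Measure.pi μ {s | ∃ h ∈ H, 2 * u < expLoss μ φ h - empLoss φ s h} ≤
      2 * Measure.pi (fun q => (μ q).prod (μ q)) (ghostEvent H φ u) := by
  set P := Measure.pi μ
  let e := MeasurableEquiv.arrowProdEquivProdArrow 𝒳 𝒳 ι
  have he : MeasurePreserving e.symm (P.prod P) (Measure.pi fun q => (μ q).prod (μ q)) :=
    (measurePreserving_arrowProdEquivProdArrow _ _ _ μ μ).symm e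
  have h_section : ∀ s ∈ {s | ∃ h ∈ H, 2 * u < expLoss μ φ h - empLoss φ s h},
      2⁻¹ ≤ P (Prod.mk s ⁻¹' (e.symm ⁻¹' ghostEvent H φ u)) := by
    rintro s ⟨h, hh, hs⟩
    refine (half_le_measure_expLoss_sub_empLoss_lt μ hφ hφab hab (hH h hh) hu hu').trans
      (measure_mono fun s' hs' => ⟨h, hh, ?_⟩)
    have hs'' : expLoss μ φ h - empLoss φ s' h < u := hs'
    change u < empLoss φ s' h - empLoss φ s h
    linarith
  have h_prod := mul_measure_le_prod h_section (P := P)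
  rw [he.measure_preimage_equiv] at h_prod
  rwa [ENNReal.inv_mul_le_iff two_ne_zero ENNReal.ofNat_ne_top] at h_prod

/-- **Vapnik–Chervonenkis inequality**. -/
theorem measure_exists_expLoss_sub_empLoss_gt_le (hH : IsMeasurableClass H) {K : ℕ}
    (hK : ∀ x : ι ⊕ ι → 𝒳, (classTrace H x).card ≤ K) (hφ : ∀ q, Measurable (φ q))
    (hφab : ∀ q p, φ q p ∈ Set.Icc (a q) (b q)) (hab : 0 < ∑ q, (b q - a q) ^ 2) {u : ℝ}
    (hu : 0 ≤ u) :
    Measure.pi μ {s | ∃ h ∈ H, 2 * u < expLoss μ φ h - empLoss φ s h} ≤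
      ENNReal.ofReal (2 * (K * Real.exp (-u ^ 2 / (2 * ∑ q, (b q - a q) ^ 2)))) := by
  rcases le_or_gt (∑ q, (b q - a q) ^ 2) (2 * u ^ 2) with hu' | hu'
  · refine (measure_exists_expLoss_sub_empLoss_gt_le_ghostEvent μ hH.measurable hφ hφab hab hu
      hu').trans ?_
    rw [ENNReal.ofReal_mul zero_le_two, ENNReal.ofReal_ofNat]
    gcongr
    exact measure_ghostEvent_le μ hH hK hφ hφab hab hu
  rcases Set.eq_empty_or_nonempty {s | ∃ h ∈ H, 2 * u < expLoss μ φ h - empLoss φ s h} with h | h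
  · simp [h]
  obtain ⟨s, h, hh, -⟩ := h
  have hK1 : (1 : ℝ) ≤ K := by
    exact_mod_cast (Finset.card_pos.2 ⟨_, comp_mem_classTrace hh (Sum.elim s s)⟩).trans_le (hK _)
  have h_exponent : -(1 / 4) ≤ -u ^ 2 / (2 * ∑ q, (b q - a q) ^ 2) := by
    rw [le_div_iff₀ (by positivity)]
    linarith
  refine prob_le_one.trans (ENNReal.one_le_ofReal.2 ?_)
  nlinarith [Real.add_one_le_exp (-u ^ 2 / (2 * ∑ q, (b q - a q) ^ 2))]

end Deviation

/-! ### Finite nets in `L¹` -/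

section Net

variable {𝒳 : Type*} [MeasurableSpace 𝒳] {H : Set (𝒳 → Bool)} {d : ℕ} {η : ℝ}

lemma exists_finset_forall_exists_not_of_card_le {β : Type*} {r : β → β → Prop}
    [Std.Irrefl r] [Std.Symm r] {s : Set β} {n : ℕ}
    (hn : ∀ F : Finset β, (F : Set β) ⊆ s → (F : Set β).Pairwise r → F.card ≤ n) :
    ∃ F : Finset β, (F : Set β) ⊆ s ∧ ∀ b ∈ s, ∃ c ∈ F, ¬ r b c := by
  classical
  by_contra! hno
  have hlarge (k : ℕ) :
      ∃ F : Finset β, F.card = k ∧ (F : Set β) ⊆ s ∧ (F : Set β).Pairwise r := by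
    induction k with
    | zero => exact ⟨∅, by simp⟩
    | succ k ih =>
      obtain ⟨F, rfl, hFs, hFr⟩ := ih
      obtain ⟨b, hbs, hb⟩ := hno F hFs
      have hbF : b ∉ F := fun hmem => irrefl b (hb b hmem)
      refine ⟨insert b F, Finset.card_insert_of_notMem hbF, ?_, ?_⟩
      · simpa [Set.insert_subset_iff] using ⟨hbs, hFs⟩
      · rw [Finset.coe_insert, Set.pairwise_insert_of_symm]
        exact ⟨hFr, fun c hc _ => hb c hc⟩
  obtain ⟨F, hcard, hFs, hFr⟩ := hlarge (n + 1)
  exact absurd (hn F hFs hFr) (by omega)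

lemma measurableSet_ne {f g : 𝒳 → Bool} (hf : Measurable f) (hg : Measurable g) :
    MeasurableSet {x | f x ≠ g x} :=
  (measurableSet_eq_fun hf hg).compl

lemma measureReal_pi_comp_eq_le (P : Measure 𝒳) [IsProbabilityMeasure P] {f g : 𝒳 → Bool}
    (hf : Measurable f) (hg : Measurable g) (hη : η ≤ P.real {x | f x ≠ g x}) (K : ℕ) :
    (Measure.pi fun _ : Fin K => P).real {x | f ∘ x = g ∘ x} ≤ Real.exp (-η) ^ K := by
  have hpi : {x : Fin K → 𝒳 | f ∘ x = g ∘ x} = Set.univ.pi fun _ => {x | f x = g x} := by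
    ext x
    simp [funext_iff]
  have heq : P.real {x | f x = g x} = 1 - P.real {x | f x ≠ g x} := by
    rw [← probReal_compl_eq_one_sub (measurableSet_ne hf hg)]
    congr 1
    ext x
    simp
  calc (Measure.pi fun _ : Fin K => P).real {x | f ∘ x = g ∘ x}
      = P.real {x | f x = g x} ^ K := by
        rw [hpi, Measure.real, Measure.pi_pi, Finset.prod_const, ENNReal.toReal_pow,
          Finset.card_univ, Fintype.card_fin]
        rfl
    _ ≤ Real.exp (-η) ^ K := by
        gcongr
        linarith [Real.one_sub_le_exp_neg η]

lemma exists_injOn_comp (P : Measure 𝒳) [IsProbabilityMeasure P] {F : Finset (𝒳 → Bool)}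
    (hF : ∀ f ∈ F, Measurable f)
    (hsep : (F : Set (𝒳 → Bool)).Pairwise fun f g => η < P.real {x | f x ≠ g x}) {K : ℕ}
    (hK : (F.card : ℝ) ^ 2 * Real.exp (-η) ^ K < 1) :
    ∃ x : Fin K → 𝒳, Set.InjOn (fun f : 𝒳 → Bool => f ∘ x) F := by
  classical
  let B : (𝒳 → Bool) × (𝒳 → Bool) → Set (Fin K → 𝒳) := fun p => {x | p.1 ∘ x = p.2 ∘ x}
  have hB : (Measure.pi fun _ : Fin K => P).real (⋃ p ∈ F.offDiag, B p) < 1 :=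
    calc (Measure.pi fun _ : Fin K => P).real (⋃ p ∈ F.offDiag, B p)
        ≤ ∑ p ∈ F.offDiag, (Measure.pi fun _ : Fin K => P).real (B p) :=
          measureReal_biUnion_finset_le _ _
      _ ≤ ∑ _p ∈ F.offDiag, Real.exp (-η) ^ K := Finset.sum_le_sum fun p hp => by
          obtain ⟨h₁, h₂, hne⟩ := Finset.mem_offDiag.1 hp
          exact measureReal_pi_comp_eq_le P (hF _ h₁) (hF _ h₂) (hsep h₁ h₂ hne).le K
      _ = (F.offDiag.card : ℝ) * Real.exp (-η) ^ K := by rw [Finset.sum_const, nsmul_eq_mul]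
      _ ≤ (F.card : ℝ) ^ 2 * Real.exp (-η) ^ K := by
          gcongr
          rw [Finset.offDiag_card, sq]
          exact_mod_cast Nat.sub_le _ _
      _ < 1 := hK
  obtain ⟨x, hx⟩ : ∃ x, x ∉ ⋃ p ∈ F.offDiag, B p := by
    by_contra! hall
    rw [Set.eq_univ_of_forall hall, probReal_univ] at hB
    exact lt_irrefl _ hB
  refine ⟨x, fun f hf g hg hfg => ?_⟩
  by_contra hne
  exact hx (Set.mem_iUnion₂.2 ⟨(f, g), Finset.mem_offDiag.2 ⟨hf, hg, hne⟩, hfg⟩)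

lemma exists_add_two_pow_mul_exp_lt_one (k : ℕ) (hη : 0 < η) :
    ∃ K : ℕ, ((K : ℝ) + 2) ^ k * Real.exp (-η) ^ K < 1 := by
  have hr : |Real.exp (-η)| < 1 := by
    rw [abs_of_pos (Real.exp_pos _)]
    exact Real.exp_lt_one_iff.2 (by linarith)
  have hlim := (tendsto_pow_const_mul_const_pow_of_abs_lt_one k hr).comp
    (Filter.tendsto_add_atTop_nat 2)
  obtain ⟨K, hK⟩ := (hlim.eventually_lt_const (show 0 < Real.exp (-η) ^ 2 by positivity)).exists
  refine ⟨K, ?_⟩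
  simp only [Function.comp_apply, pow_add _ K 2, ← mul_assoc, Nat.cast_add, Nat.cast_ofNat] at hK
  exact (mul_lt_iff_lt_one_left (by positivity)).1 hK

lemma exists_forall_card_le_of_pairwise (P : Measure 𝒳) [IsProbabilityMeasure P]
    (hH : ∀ h ∈ H, Measurable h) (hd : classVCDim H ≤ d) (hη : 0 < η) :
    ∃ n : ℕ, ∀ F : Finset (𝒳 → Bool), (F : Set (𝒳 → Bool)) ⊆ H →
      ((F : Set (𝒳 → Bool)).Pairwise fun f g => η < P.real {x | f x ≠ g x}) → F.card ≤ n := by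
  obtain ⟨K, hK⟩ := exists_add_two_pow_mul_exp_lt_one ((d + 1) * 2) hη
  refine ⟨(K + 1) ^ d, fun F hF hsep => ?_⟩
  by_contra! hcard
  obtain ⟨F', hF'F, hF'⟩ := Finset.exists_subset_card_eq (Nat.succ_le_of_lt hcard)
  have hF'H : ∀ f ∈ F', f ∈ H := fun f hf => hF (hF'F hf)
  have hpow : (K + 1) ^ d + 1 ≤ (K + 2) ^ (d + 1) :=
    calc (K + 1) ^ d + 1 ≤ (K + 2) ^ d + (K + 2) ^ d :=
          add_le_add (Nat.pow_le_pow_left (by omega) d) (Nat.one_le_pow _ _ (by omega))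
      _ ≤ (K + 2) ^ (d + 1) := by rw [← mul_two, pow_succ]; exact Nat.mul_le_mul_left _ (by omega)
  have hF'K : (F'.card : ℝ) ^ 2 * Real.exp (-η) ^ K < 1 := by
    refine lt_of_le_of_lt ?_ hK
    rw [hF', pow_mul]
    gcongr
    exact_mod_cast hpow
  obtain ⟨x, hx⟩ := exists_injOn_comp P (fun f hf => hH f (hF'H f hf))
    (hsep.mono (Finset.coe_subset.2 hF'F)) hF'K
  have hle : F'.card ≤ (classTrace H x).card :=
    Finset.card_le_card_of_injOn _ (fun f hf => comp_mem_classTrace (hF'H f hf) x) hx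
  have hle' := (card_classTrace_le_sum_choose hd x).trans (sum_range_choose_le_pow _ _)
  rw [Fintype.card_fin] at hle'
  omega

theorem exists_finset_net (ρ : Measure 𝒳) [IsFiniteMeasure ρ] (hH : ∀ h ∈ H, Measurable h)
    (hd : classVCDim H ≤ d) (hη : 0 < η) :
    ∃ F : Finset (𝒳 → Bool), (F : Set (𝒳 → Bool)) ⊆ H ∧
      ∀ h ∈ H, ∃ f ∈ F, ρ.real {x | h x ≠ f x} ≤ η := by
  obtain ⟨n, hn⟩ : ∃ n : ℕ, ∀ F : Finset (𝒳 → Bool), (F : Set (𝒳 → Bool)) ⊆ H →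
      ((F : Set (𝒳 → Bool)).Pairwise fun f g => η < ρ.real {x | f x ≠ g x}) → F.card ≤ n := by
    rcases eq_or_ne ρ 0 with rfl | hρ
    · refine ⟨1, fun F _ hF => Finset.card_le_one.2 fun f hf g hg => ?_⟩
      by_contra hne
      simpa [hη.not_gt] using hF hf hg hne
    have : NeZero ρ := ⟨hρ⟩
    have hpos : 0 < ρ.real Set.univ := measureReal_univ_pos
    obtain ⟨n, hn⟩ := exists_forall_card_le_of_pairwise ((ρ Set.univ)⁻¹ • ρ) hH hd
      (div_pos hη hpos)
    refine ⟨n, fun F hF hsep => hn F hF (hsep.mono' fun f g hfg => ?_)⟩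
    rw [measureReal_ennreal_smul_apply, ENNReal.toReal_inv, div_eq_inv_mul]
    exact mul_lt_mul_of_pos_left hfg (inv_pos.2 hpos)
  let r : (𝒳 → Bool) → (𝒳 → Bool) → Prop := fun f g => η < ρ.real {x | f x ≠ g x}
  have : Std.Irrefl r := ⟨fun f => by simpa [r] using hη.le⟩
  have : Std.Symm r := ⟨fun f g hfg => by simpa only [r, ne_comm] using hfg⟩
  simpa only [r, not_lt] using exists_finset_forall_exists_not_of_card_le (r := r) hn

end Net

/-! ### Polynomial approximation in `L¹` -/

section Approximation

variable {α : Type*} [TopologicalSpace α] [CompactSpace α] [MeasurableSpace α] {ρ : Measure α}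
  [IsFiniteMeasure ρ] {A : Subalgebra ℝ C(α, ℝ)} {u : α → ℝ} {η : ℝ}

lemma integrable_of_continuous [OpensMeasurableSpace α] {f : α → ℝ} (hf : Continuous f) :
    Integrable f ρ :=
  hf.integrable_of_hasCompactSupport (HasCompactSupport.of_compactSpace f)

variable [TopologicalSpace.PseudoMetrizableSpace α] [BorelSpace α]

theorem exists_mem_subalgebra_integral_abs_sub_le (hA : A.SeparatesPoints) (hu : Integrable u ρ)
    (hη : 0 < η) : ∃ f ∈ A, ∫ x, |u x - f x| ∂ρ ≤ η := by
  set M := ρ.real Set.univ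
  have : 0 ≤ M := measureReal_nonneg
  obtain ⟨g, hug, hg⟩ := hu.exists_boundedContinuous_integral_sub_le (half_pos hη)
  obtain ⟨⟨f, hfA⟩, hgf⟩ :=
    ContinuousMap.exists_mem_subalgebra_near_continuous_of_separatesPoints A hA g g.continuous
      (η / (2 * (M + 1))) (by positivity)
  have hf : Integrable f ρ := integrable_of_continuous f.continuous
  have hpt (x : α) : |u x - f x| ≤ ‖u x - g x‖ + η / (2 * (M + 1)) :=
    calc |u x - f x| ≤ |u x - g x| + |g x - f x| := abs_sub_le _ _ _
      _ ≤ ‖u x - g x‖ + η / (2 * (M + 1)) := by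
          rw [abs_sub_comm (g x), Real.norm_eq_abs]
          gcongr
          exact (hgf x).le
  refine ⟨f, hfA, ?_⟩
  calc ∫ x, |u x - f x| ∂ρ ≤ ∫ x, (‖u x - g x‖ + η / (2 * (M + 1))) ∂ρ :=
        integral_mono (hu.sub hf).abs ((hu.sub hg).norm.add (integrable_const _)) hpt
    _ = ∫ x, ‖u x - g x‖ ∂ρ + M * (η / (2 * (M + 1))) := by
        have hug' : Integrable (fun x => ‖u x - g x‖) ρ := (hu.sub hg).norm
        rw [integral_add hug' (integrable_const _), integral_const, smul_eq_mul]
    _ ≤ η / 2 + η / 2 := by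
        gcongr
        rw [← mul_div_assoc, div_le_div_iff₀ (by positivity) (by norm_num)]
        nlinarith
    _ = η := add_halves η

/-- Approximating `u / w` in `L¹` of the measure `w ∂ρ` is the same as approximating `u` by
multiples of `w` in `L¹` of `ρ`. -/
theorem exists_mem_subalgebra_integral_abs_sub_mul_le (hA : A.SeparatesPoints) {w : α → NNReal}
    (hw : Continuous w) (hu : Integrable u ρ) (huw : ∀ x, w x = 0 → u x = 0) (hη : 0 < η) :
    ∃ f ∈ A, ∫ x, |u x - w x * f x| ∂ρ ≤ η := by
  have hmul (x : α) : w x * (u x / w x) = u x := by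
    rcases eq_or_ne (w x) 0 with h | h
    · simp [h, huw x h]
    · field_simp
  have hwi : Integrable (fun x => (w x : ℝ)) ρ :=
    integrable_of_continuous (NNReal.continuous_coe.comp hw)
  have : IsFiniteMeasure (ρ.withDensity fun x => (w x : ENNReal)) := by
    simpa using isFiniteMeasure_withDensity_ofReal hwi.2
  have hdiv : Integrable (fun x => u x / w x) (ρ.withDensity fun x => (w x : ENNReal)) := by
    rw [integrable_withDensity_iff_integrable_smul hw.measurable]
    simpa only [NNReal.smul_def, smul_eq_mul, hmul] using hu
  obtain ⟨f, hfA, hf⟩ := exists_mem_subalgebra_integral_abs_sub_le hA hdiv hη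
  refine ⟨f, hfA, le_of_eq_of_le ?_ hf⟩
  rw [integral_withDensity_eq_integral_smul hw.measurable]
  refine integral_congr_ae (ae_of_all _ fun x => ?_)
  simp only [NNReal.smul_def, smul_eq_mul]
  rw [← abs_of_nonneg (w x).coe_nonneg, ← abs_mul, abs_of_nonneg (w x).coe_nonneg, mul_sub, hmul]

end Approximation

section Polynomial

variable {n : ℕ} {X : Set (Fin n → ℝ)}

lemma continuous_eval_coe (p : MvPolynomial (Fin n) ℝ) :
    Continuous fun x : X => MvPolynomial.eval (x : Fin n → ℝ) p :=
  p.continuous_eval.comp continuous_subtype_val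

/-- The restriction of polynomials to `X`, as an algebra homomorphism to the continuous functions
on `X`; its range is the subalgebra to which the Stone–Weierstrass theorem is applied. -/
noncomputable def polynomialMap (X : Set (Fin n → ℝ)) : MvPolynomial (Fin n) ℝ →ₐ[ℝ] C(X, ℝ) :=
  MvPolynomial.aeval fun i =>
    ⟨fun x : X => (x : Fin n → ℝ) i, (continuous_apply i).comp continuous_subtype_val⟩

lemma polynomialMap_apply (p : MvPolynomial (Fin n) ℝ) (x : X) :
    polynomialMap X p x = MvPolynomial.eval (x : Fin n → ℝ) p := by
  change ContinuousMap.evalAlgHom ℝ ℝ x (MvPolynomial.aeval _ p) = _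
  rw [MvPolynomial.comp_aeval_apply, MvPolynomial.aeval_eq_eval]
  rfl

lemma separatesPoints_range_polynomialMap (X : Set (Fin n → ℝ)) :
    (polynomialMap X).range.SeparatesPoints := by
  intro x y hxy
  obtain ⟨i, hi⟩ := Function.ne_iff.1 (Subtype.coe_ne_coe.2 hxy)
  refine ⟨polynomialMap X (MvPolynomial.X i), ⟨_, ⟨MvPolynomial.X i, rfl⟩, rfl⟩, ?_⟩
  simpa only [polynomialMap_apply, MvPolynomial.eval_X] using hi

theorem exists_constantCoeff_eq_zero_integral_abs_sub_le [CompactSpace X] (ρ : Measure X)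
    [IsFiniteMeasure ρ] {u : X → ℝ} (hu : Integrable u ρ)
    (hu0 : ∀ x : X, (x : Fin n → ℝ) = 0 → u x = 0) {η : ℝ} (hη : 0 < η) :
    ∃ p : MvPolynomial (Fin n) ℝ, MvPolynomial.constantCoeff p = 0 ∧
      ∫ x : X, |u x - MvPolynomial.eval (x : Fin n → ℝ) p| ∂ρ ≤ η := by
  have hw : Continuous fun x : X => ∑ i, ‖(x : Fin n → ℝ) i‖₊ ^ 2 :=
    continuous_finsetSum _ fun i _ =>
      ((continuous_apply i).comp continuous_subtype_val).nnnorm.pow 2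
  have hw0 (x : X) (hx : ∑ i, ‖(x : Fin n → ℝ) i‖₊ ^ 2 = 0) : (x : Fin n → ℝ) = 0 :=
    funext fun i => by simpa using Finset.sum_eq_zero_iff.1 hx i (Finset.mem_univ i)
  obtain ⟨_, ⟨q, rfl⟩, hq⟩ := exists_mem_subalgebra_integral_abs_sub_mul_le
    (separatesPoints_range_polynomialMap X) hw hu (fun x hx => hu0 x (hw0 x hx)) hη
  refine ⟨(∑ i, MvPolynomial.X i ^ 2) * q, by simp, ?_⟩
  simpa [polynomialMap_apply] using hq

end Polynomial

/-! ### Label-wise moments -/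

namespace LabeledDomain

variable {𝒳 : Type*} [MeasurableSpace 𝒳]

instance (D : LabeledDomain 𝒳) : IsProbabilityMeasure D.μ := D.isProb

lemma measurableSet_label_eq (D : LabeledDomain 𝒳) (c : Bool) :
    MeasurableSet {x | D.label x = c} :=
  D.measurable_label (measurableSet_singleton c)

lemma labelProb_mul_integral_condLabel (D : LabeledDomain 𝒳) (c : Bool) (g : 𝒳 → ℝ) :
    D.labelProb c * ∫ x, g x ∂(D.condLabel c) = ∫ x in {x | D.label x = c}, g x ∂D.μ := by
  rw [labelProb, condLabel, ProbabilityTheory.cond, ← setAverage_eq', ← smul_eq_mul,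
    measure_smul_setAverage _ (measure_ne_top _ _)]

/-- The difference between the integrals of `g` over the points with label `c` of two domains. -/
noncomputable def labelDiff (D D' : LabeledDomain 𝒳) (c : Bool) (g : 𝒳 → ℝ) : ℝ :=
  ∫ x in {x | D.label x = c}, g x ∂D.μ - ∫ x in {x | D'.label x = c}, g x ∂D'.μ

lemma abs_labelDiff_sub_le {D D' : LabeledDomain 𝒳} {ρ : Measure 𝒳} (hρ : D.μ + D'.μ ≤ ρ)
    (c : Bool) {f g : 𝒳 → ℝ} (hf : Integrable f ρ) (hg : Integrable g ρ) :
    |D.labelDiff D' c f - D.labelDiff D' c g| ≤ ∫ x, |f x - g x| ∂ρ := by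
  have hD : D.μ ≤ ρ := (Measure.le_add_right le_rfl).trans hρ
  have hD' : D'.μ ≤ ρ := (Measure.le_add_left le_rfl).trans hρ
  have hfg : Integrable (fun x => |f x - g x|) ρ := (hf.sub hg).abs
  have hle {ν : Measure 𝒳} (hν : ν ≤ ρ) (A : Set 𝒳) :
      |∫ x in A, f x ∂ν - ∫ x in A, g x ∂ν| ≤ ∫ x, |f x - g x| ∂ν := by
    rw [← integral_sub (hf.mono_measure hν).integrableOn (hg.mono_measure hν).integrableOn]
    exact abs_integral_le_integral_abs.trans
      (setIntegral_le_integral (hfg.mono_measure hν) (ae_of_all _ fun x => abs_nonneg _))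
  calc |D.labelDiff D' c f - D.labelDiff D' c g|
      ≤ ∫ x, |f x - g x| ∂D.μ + ∫ x, |f x - g x| ∂D'.μ := by
        rw [labelDiff, labelDiff, sub_sub_sub_comm]
        exact (abs_sub _ _).trans (add_le_add (hle hD _) (hle hD' _))
    _ = ∫ x, |f x - g x| ∂(D.μ + D'.μ) :=
        (integral_add_measure (hfg.mono_measure hD) (hfg.mono_measure hD')).symm
    _ ≤ ∫ x, |f x - g x| ∂ρ :=
        integral_mono_measure hρ (ae_of_all _ fun x => abs_nonneg _) hfg

lemma sum_setIntegral_indicator (D : LabeledDomain 𝒳) {E : Bool → Set 𝒳}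
    (hE : ∀ c, MeasurableSet (E c)) :
    ∑ c, ∫ x in {x | D.label x = c}, (E c).indicator 1 x ∂D.μ =
      D.μ.real {x | x ∈ E (D.label x)} := by
  have hint (c : Bool) : ∫ x in {x | D.label x = c}, (E c).indicator (1 : 𝒳 → ℝ) x ∂D.μ =
      D.μ.real (E c ∩ {x | D.label x = c}) := by
    rw [integral_indicator_one (hE c), measureReal_restrict_apply (hE c)]
  rw [Fintype.sum_bool, hint, hint,
    ← measureReal_inter_add_sdiff (s := {x | x ∈ E (D.label x)}) (D.measurableSet_label_eq true)]
  congr 2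
  all_goals
    ext x
    cases h : D.label x <;> simp [h]

lemma sum_labelDiff_indicator (D D' : LabeledDomain 𝒳) {E : Bool → Set 𝒳}
    (hE : ∀ c, MeasurableSet (E c)) :
    ∑ c, D.labelDiff D' c ((E c).indicator 1) =
      D.μ.real {x | x ∈ E (D.label x)} - D'.μ.real {x | x ∈ E (D'.label x)} := by
  simp only [labelDiff, Finset.sum_sub_distrib, sum_setIntegral_indicator _ hE]

end LabeledDomain

section Moments

open LabeledDomain

variable {n : ℕ} {X : Set (Fin n → ℝ)}

/-- The difference of the moments with multi-index `e` of the points with label `c` of two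
domains. -/
noncomputable def labelMomentDiff (D D' : LabeledDomain X) (c : Bool) (e : Fin n → ℕ) : ℝ :=
  D.labelDiff D' c fun x => ∏ j, (x : Fin n → ℝ) j ^ e j

lemma labelMomentDiv_eq_sum_labelMomentDiff (k : ℕ) (D D' : LabeledDomain X) :
    labelMomentDiv k D D' =
      ∑ c, ∑ e ∈ Finset.piAntidiag Finset.univ k, |labelMomentDiff D D' c e| := by
  simp only [labelMomentDiv, labelProb_mul_integral_condLabel, labelMomentDiff, labelDiff]

lemma integral_eval_coe [CompactSpace X] (ν : Measure X) [IsFiniteMeasure ν]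
    (p : MvPolynomial (Fin n) ℝ) :
    ∫ x : X, MvPolynomial.eval (x : Fin n → ℝ) p ∂ν =
      ∑ e ∈ p.support, p.coeff e * ∫ x : X, ∏ j, (x : Fin n → ℝ) j ^ e j ∂ν := by
  simp_rw [MvPolynomial.eval_eq']
  rw [integral_finsetSum]
  · simp_rw [integral_const_mul]
  · exact fun e _ => integrable_of_continuous <| continuous_const.mul <|
      continuous_finsetProd _ fun i _ => ((continuous_apply i).comp continuous_subtype_val).pow _

lemma labelDiff_eval [CompactSpace X] (D D' : LabeledDomain X) (c : Bool)
    (p : MvPolynomial (Fin n) ℝ) :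
    (D.labelDiff D' c fun x => MvPolynomial.eval (x : Fin n → ℝ) p) =
      ∑ e ∈ p.support, p.coeff e * labelMomentDiff D D' c e := by
  simp only [labelMomentDiff, labelDiff, mul_sub, Finset.sum_sub_distrib, integral_eval_coe]

lemma sum_mem_Icc_totalDegree {σ R : Type*} [Fintype σ] [CommSemiring R] {p : MvPolynomial σ R}
    (hp : MvPolynomial.constantCoeff p = 0) {e : σ →₀ ℕ} (he : e ∈ p.support) :
    ∑ j, e j ∈ Finset.Icc 1 p.totalDegree := by
  refine Finset.mem_Icc.2 ⟨Nat.one_le_iff_ne_zero.2 fun h => ?_, ?_⟩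
  · have he0 : e = 0 := Finsupp.ext fun j => Finset.sum_eq_zero_iff.1 h j (Finset.mem_univ j)
    rw [he0, MvPolynomial.mem_support_iff] at he
    exact he hp
  · rw [← Finsupp.sum_fintype e (fun _ m => m) fun _ => rfl]
    exact MvPolynomial.le_totalDegree he

lemma sum_filter_le_sum_piAntidiag {σ : Type*} [Fintype σ] [DecidableEq σ] (s : Finset (σ →₀ ℕ))
    {M : (σ → ℕ) → ℝ} (hM : ∀ e, 0 ≤ M e) (j : ℕ) :
    ∑ e ∈ s with ∑ i, e i = j, M e ≤ ∑ e ∈ Finset.piAntidiag Finset.univ j, M e := by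
  classical
  rw [← Finset.sum_image (g := fun e : σ →₀ ℕ => (e : σ → ℕ)) (f := M)
    fun _ _ _ _ h => DFunLike.coe_injective h]
  refine Finset.sum_le_sum_of_subset_of_nonneg (fun e he => ?_) fun e _ _ => hM e
  obtain ⟨e', he', rfl⟩ := Finset.mem_image.1 he
  exact Finset.mem_piAntidiag.2 ⟨(Finset.mem_filter.1 he').2, fun _ _ => Finset.mem_univ _⟩

lemma abs_labelDiff_eval_le [CompactSpace X] (D D' : LabeledDomain X) (c : Bool)
    {p : MvPolynomial (Fin n) ℝ} (hp : MvPolynomial.constantCoeff p = 0) {k : ℕ} {a : ℝ}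
    (hk : p.totalDegree ≤ k) (ha : ∑ e ∈ p.support, |p.coeff e| ≤ a) :
    |D.labelDiff D' c fun x => MvPolynomial.eval (x : Fin n → ℝ) p| ≤
      a * ∑ j ∈ Finset.Icc 1 k, ∑ e ∈ Finset.piAntidiag Finset.univ j,
        |labelMomentDiff D D' c e| := by
  have ha0 : 0 ≤ a := (Finset.sum_nonneg fun _ _ => abs_nonneg _).trans ha
  have hcoeff (e : Fin n →₀ ℕ) (he : e ∈ p.support) : |p.coeff e| ≤ a :=
    (Finset.single_le_sum (f := fun e => |p.coeff e|) (fun _ _ => abs_nonneg _) he).trans ha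
  have hdeg (e : Fin n →₀ ℕ) (he : e ∈ p.support) : ∑ j, e j ∈ Finset.Icc 1 k :=
    Finset.Icc_subset_Icc_right hk (sum_mem_Icc_totalDegree hp he)
  rw [labelDiff_eval]
  calc |∑ e ∈ p.support, p.coeff e * labelMomentDiff D D' c e|
      ≤ ∑ e ∈ p.support, |p.coeff e| * |labelMomentDiff D D' c e| := by
        simp_rw [← abs_mul]
        exact Finset.abs_sum_le_sum_abs _ _
    _ ≤ ∑ e ∈ p.support, a * |labelMomentDiff D D' c e| :=
        Finset.sum_le_sum fun e he => mul_le_mul_of_nonneg_right (hcoeff e he) (abs_nonneg _)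
    _ = a * ∑ j ∈ Finset.Icc 1 k, ∑ e ∈ p.support with ∑ i, e i = j,
          |labelMomentDiff D D' c e| := by
        rw [← Finset.mul_sum, Finset.sum_fiberwise_of_maps_to hdeg]
    _ ≤ a * ∑ j ∈ Finset.Icc 1 k, ∑ e ∈ Finset.piAntidiag Finset.univ j,
          |labelMomentDiff D D' c e| := by
        gcongr
        exact sum_filter_le_sum_piAntidiag _ (fun e => abs_nonneg _) _

lemma eventually_sum_abs_labelDiff_le [CompactSpace X] (ρ : Measure X) [IsFiniteMeasure ρ]
    {u : Bool → X → ℝ} (hu : ∀ c, Integrable (u c) ρ)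
    (hu0 : ∀ c, ∀ x : X, (x : Fin n → ℝ) = 0 → u c x = 0) {η : ℝ} (hη : 0 < η) :
    ∀ᶠ r : ℕ × ℝ in Filter.atTop, ∀ D D' : LabeledDomain X, D.μ + D'.μ ≤ ρ →
      ∑ c, |D.labelDiff D' c (u c)| ≤
        η + r.2 * ∑ j ∈ Finset.Icc 1 r.1, labelMomentDiv j D D' := by
  choose p hp hup using fun c =>
    exists_constantCoeff_eq_zero_integral_abs_sub_le ρ (hu c) (hu0 c) (half_pos hη)
  filter_upwards [Filter.eventually_all.2 fun c =>
    Filter.eventually_ge_atTop ((p c).totalDegree, ∑ e ∈ (p c).support, |(p c).coeff e|)]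
    with r hr D D' hρ
  have hle (c : Bool) : |D.labelDiff D' c (u c)| ≤ η / 2 + r.2 * ∑ j ∈ Finset.Icc 1 r.1,
      ∑ e ∈ Finset.piAntidiag Finset.univ j, |labelMomentDiff D D' c e| := by
    have hpoly := abs_labelDiff_eval_le D D' c (hp c) (hr c).1 (hr c).2
    have hsub := (abs_labelDiff_sub_le hρ c (hu c)
      (integrable_of_continuous (continuous_eval_coe (p c)))).trans (hup c)
    linarith [abs_sub_abs_le_abs_sub (D.labelDiff D' c (u c))
      (D.labelDiff D' c fun x => MvPolynomial.eval (x : Fin n → ℝ) (p c))]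
  refine (Finset.sum_le_sum fun c _ => hle c).trans_eq ?_
  simp_rw [labelMomentDiv_eq_sum_labelMomentDiff]
  rw [Finset.sum_add_distrib, ← Finset.mul_sum, Finset.sum_comm, Fintype.sum_bool (fun _ => η / 2),
    add_halves]

lemma eventually_abs_measureReal_sub_le [CompactSpace X] (ρ : Measure X) [IsFiniteMeasure ρ]
    {E : Bool → Set X} (hE : ∀ c, MeasurableSet (E c))
    (hE0 : ∀ c, ∀ x ∈ E c, (x : Fin n → ℝ) ≠ 0) {η : ℝ} (hη : 0 < η) :
    ∀ᶠ r : ℕ × ℝ in Filter.atTop, ∀ D D' : LabeledDomain X, D.μ + D'.μ ≤ ρ →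
      |D.μ.real {x | x ∈ E (D.label x)} - D'.μ.real {x | x ∈ E (D'.label x)}| ≤
        η + r.2 * ∑ j ∈ Finset.Icc 1 r.1, labelMomentDiv j D D' := by
  filter_upwards [eventually_sum_abs_labelDiff_le ρ (u := fun c => (E c).indicator 1)
    (fun c => (integrable_const (1 : ℝ)).indicator (hE c))
    (fun c x hx => Set.indicator_of_notMem (fun hxE => hE0 c x hxE hx) _) hη] with r hr D D' hρ
  rw [← sum_labelDiff_indicator D D' hE]
  exact (Finset.abs_sum_le_sum_abs _ _).trans (hr D D' hρ)

end Moments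

/-! ### Comparing the errors on two domains -/

section Comparison

variable {𝒳 : Type*} [MeasurableSpace 𝒳]

lemma jointError_nonneg (H : Set (𝒳 → Bool)) (D D' : LabeledDomain 𝒳) :
    0 ≤ jointError H D D' :=
  Real.iInf_nonneg fun _ => add_nonneg measureReal_nonneg measureReal_nonneg

-- If the labels of two domains differ at a point, every hypothesis errs there on one of them.
lemma min_measureReal_singleton_le_jointError {H : Set (𝒳 → Bool)} (hH : H.Nonempty)
    (D D' : LabeledDomain 𝒳) {x : 𝒳} (hx : D.label x ≠ D'.label x) :
    min (D.μ.real {x}) (D'.μ.real {x}) ≤ jointError H D D' := by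
  have : Nonempty H := hH.to_subtype
  refine le_ciInf fun ⟨h, _⟩ => ?_
  have hmiss (G : LabeledDomain 𝒳) (hG : h x ≠ G.label x) : G.μ.real {x} ≤ G.error h :=
    measureReal_mono (by simpa using hG)
  rcases ne_or_eq (h x) (D.label x) with h₁ | h₁
  · exact (min_le_left _ _).trans ((hmiss D h₁).trans (le_add_of_nonneg_left measureReal_nonneg))
  · exact (min_le_right _ _).trans
      ((hmiss D' (h₁ ▸ hx)).trans (le_add_of_nonneg_right measureReal_nonneg))

lemma measureReal_ne_label_inter_singleton (D : LabeledDomain 𝒳) (h : 𝒳 → Bool) (x : 𝒳) :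
    D.μ.real ({y | h y ≠ D.label y} ∩ {x}) = if h x ≠ D.label x then D.μ.real {x} else 0 := by
  split_ifs with hx
  · rw [Set.inter_eq_right.2 (Set.singleton_subset_iff.2 hx)]
  · rw [Set.inter_singleton_eq_empty.2 hx, measureReal_empty]

lemma abs_measureReal_ne_label_inter_subsingleton_sub_le {H : Set (𝒳 → Bool)} (hH : H.Nonempty)
    (D D' : LabeledDomain 𝒳) {Z : Set 𝒳} (hZ : Z.Subsingleton) (h : 𝒳 → Bool) :
    |D.μ.real ({x | h x ≠ D.label x} ∩ Z) - D'.μ.real ({x | h x ≠ D'.label x} ∩ Z)| ≤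
      jointError H D D' + |D.μ.real Z - D'.μ.real Z| := by
  have hJ := jointError_nonneg H D D'
  rcases hZ.eq_empty_or_singleton with rfl | ⟨x, rfl⟩
  · simpa using hJ
  rw [measureReal_ne_label_inter_singleton, measureReal_ne_label_inter_singleton]
  have hD : 0 ≤ D.μ.real {x} := measureReal_nonneg
  have hD' : 0 ≤ D'.μ.real {x} := measureReal_nonneg
  have habs := abs_nonneg (D.μ.real {x} - D'.μ.real {x})
  rcases eq_or_ne (D.label x) (D'.label x) with hx | hx
  · rw [hx]
    split_ifs
    · linarith
    · simpa using add_nonneg hJ habs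
  · have hmax : max (D.μ.real {x}) (D'.μ.real {x}) ≤
        jointError H D D' + |D.μ.real {x} - D'.μ.real {x}| := by
      rw [abs_sub_comm, ← max_sub_min_eq_abs]
      linarith [min_measureReal_singleton_le_jointError hH D D' hx]
    obtain ⟨h₁, h₂⟩ := max_le_iff.1 hmax
    rcases ne_or_eq (h x) (D.label x) with hh | hh
    · have : h x = D'.label x := by
        rw [Bool.eq_not_of_ne hh, Bool.eq_not_of_ne hx, Bool.not_not]
      simpa [hx.symm, this, abs_of_nonneg hD] using h₁
    · simpa [hh, hx, abs_of_nonneg hD'] using h₂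

lemma abs_measureReal_ne_label_inter_sub_le (D : LabeledDomain 𝒳) {f h : 𝒳 → Bool}
    (hf : Measurable f) (hh : Measurable h) {E : Set 𝒳} (hE : MeasurableSet E) :
    |D.μ.real ({x | h x ≠ D.label x} ∩ E) - D.μ.real ({x | f x ≠ D.label x} ∩ E)| ≤
      D.μ.real {x | h x ≠ f x} := by
  have hmeas {g : 𝒳 → Bool} (hg : Measurable g) : MeasurableSet ({x | g x ≠ D.label x} ∩ E) :=
    (measurableSet_ne hg D.measurable_label).inter hE
  refine (abs_measureReal_sub_le_measureReal_symmDiff (hmeas hh).nullMeasurableSet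
    (hmeas hf).nullMeasurableSet).trans (measureReal_mono fun x hx => ?_)
  rcases hx with ⟨⟨hxh, hxE⟩, hxf⟩ | ⟨⟨hxf, hxE⟩, hxh⟩ <;> intro hxx <;> simp_all

end Comparison

section MomentComparison

variable {n : ℕ} {X : Set (Fin n → ℝ)}

lemma measurableSet_coe_ne_zero : MeasurableSet {x : X | (x : Fin n → ℝ) ≠ 0} :=
  (measurable_subtype_coe (measurableSet_singleton 0)).compl

variable [CompactSpace X]

lemma eventually_forall_mem_abs_measureReal_ne_label_sub_le (ρ : Measure X) [IsFiniteMeasure ρ]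
    {H : Set (X → Bool)} (hH : ∀ h ∈ H, Measurable h) {d : ℕ} (hd : classVCDim H ≤ d) {η : ℝ}
    (hη : 0 < η) :
    ∀ᶠ r : ℕ × ℝ in Filter.atTop, ∀ D D' : LabeledDomain X, D.μ + D'.μ ≤ ρ → ∀ h ∈ H,
      |D.μ.real ({x | h x ≠ D.label x} ∩ {x | (x : Fin n → ℝ) ≠ 0}) -
          D'.μ.real ({x | h x ≠ D'.label x} ∩ {x | (x : Fin n → ℝ) ≠ 0})| ≤
        η + r.2 * ∑ j ∈ Finset.Icc 1 r.1, labelMomentDiv j D D' := by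
  obtain ⟨F, hFH, hF⟩ := exists_finset_net ρ hH hd (half_pos hη)
  have hev := (Filter.eventually_all_finset F).2 fun f hf => eventually_abs_measureReal_sub_le ρ
    (E := fun c => {x | f x ≠ c} ∩ {x : X | (x : Fin n → ℝ) ≠ 0})
    (fun c => (measurableSet_ne (hH f (hFH hf)) measurable_const).inter measurableSet_coe_ne_zero)
    (fun c x hx => hx.2) (half_pos hη)
  filter_upwards [hev] with r hr D D' hρ h hh
  obtain ⟨f, hf, hhf⟩ := hF h hh
  have hsum : D.μ.real {x | h x ≠ f x} + D'.μ.real {x | h x ≠ f x} ≤ ρ.real {x | h x ≠ f x} := by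
    rw [← measureReal_add_apply]
    exact ENNReal.toReal_mono (measure_ne_top _ _) (hρ _)
  have hD := abs_measureReal_ne_label_inter_sub_le D (hH f (hFH hf)) (hH h hh)
    measurableSet_coe_ne_zero
  have hD' := abs_measureReal_ne_label_inter_sub_le D' (hH f (hFH hf)) (hH h hh)
    measurableSet_coe_ne_zero
  have hDD' := hr f hf D D' hρ
  simp only [abs_le, Set.mem_ofPred_eq, ← Set.ofPred_and] at hD hD' hDD' ⊢
  constructor <;> linarith

lemma eventually_abs_measureReal_origin_sub_le (ρ : Measure X) [IsFiniteMeasure ρ] {η : ℝ}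
    (hη : 0 < η) :
    ∀ᶠ r : ℕ × ℝ in Filter.atTop, ∀ D D' : LabeledDomain X, D.μ + D'.μ ≤ ρ →
      |D.μ.real {x : X | (x : Fin n → ℝ) ≠ 0}ᶜ - D'.μ.real {x : X | (x : Fin n → ℝ) ≠ 0}ᶜ| ≤
        η + r.2 * ∑ j ∈ Finset.Icc 1 r.1, labelMomentDiv j D D' := by
  filter_upwards [eventually_abs_measureReal_sub_le ρ (fun _ => measurableSet_coe_ne_zero)
    (fun _ _ hx => hx) hη] with r hr D D' hρ
  rw [probReal_compl_eq_one_sub measurableSet_coe_ne_zero,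
    probReal_compl_eq_one_sub measurableSet_coe_ne_zero, sub_sub_sub_cancel_left, abs_sub_comm]
  exact hr D D' hρ

/-- The moments of positive order do not see the origin, where the errors are compared by the best
joint error instead. -/
theorem exists_abs_error_sub_error_le (ρ : Measure X) [IsFiniteMeasure ρ] {H : Set (X → Bool)}
    (hH : ∀ h ∈ H, Measurable h) {d : ℕ} (hd : classVCDim H ≤ d) {ε : ℝ} (hε : 0 < ε) :
    ∃ (k : ℕ) (a : ℝ), ∀ D D' : LabeledDomain X, D.μ + D'.μ ≤ ρ → ∀ h ∈ H,
      |D.error h - D'.error h| ≤ jointError H D D' + ε +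
        a * ∑ j ∈ Finset.Icc 1 k, labelMomentDiv j D D' := by
  obtain ⟨⟨k, a⟩, haway, horigin⟩ :=
    ((eventually_forall_mem_abs_measureReal_ne_label_sub_le ρ hH hd (half_pos hε)).and
      (eventually_abs_measureReal_origin_sub_le ρ (half_pos hε))).exists
  refine ⟨k, 2 * a, fun D D' hρ h hh => ?_⟩
  set E : Set X := {x | (x : Fin n → ℝ) ≠ 0}
  have hE : MeasurableSet E := measurableSet_coe_ne_zero
  have hsub : Eᶜ.Subsingleton := fun x hx y hy =>
    Subtype.ext ((not_not.1 hx).trans (not_not.1 hy).symm)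
  have hzero := abs_measureReal_ne_label_inter_subsingleton_sub_le ⟨h, hh⟩ D D' hsub h
  have hsplit (G : LabeledDomain X) : G.error h =
      G.μ.real ({x | h x ≠ G.label x} ∩ E) + G.μ.real ({x | h x ≠ G.label x} ∩ Eᶜ) :=
    (measureReal_inter_add_sdiff hE).symm
  rw [hsplit D, hsplit D', add_sub_add_comm]
  refine (abs_add_le _ _).trans ?_
  linarith [haway D D' hρ h hh, horigin D D' hρ]

end MomentComparison

/-! ### Learning from several sources -/

section Sources

variable {𝒳 : Type*} [MeasurableSpace 𝒳] {N : ℕ} (S : Fin N → LabeledDomain 𝒳) (nS : Fin N → ℕ)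
  (α : Fin N → ℝ)

/-- The loss of the sample points in the `α`-weighted empirical error: a mislabeled point of the
`i`-th dataset costs its share `α i / nS i`. -/
noncomputable def sourceLoss (q : (i : Fin N) × Fin (nS i)) (p : 𝒳 × Bool) : ℝ :=
  if p.2 ≠ (S q.1).label p.1 then α q.1 / nS q.1 else 0

lemma measurable_sourceLoss (q : (i : Fin N) × Fin (nS i)) : Measurable (sourceLoss S nS α q) :=
  Measurable.ite
    (measurableSet_ne measurable_snd ((S q.1).measurable_label.comp measurable_fst))
    measurable_const measurable_const

lemma sourceLoss_mem_Icc (q : (i : Fin N) × Fin (nS i)) (p : 𝒳 × Bool) :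
    sourceLoss S nS α q p ∈ Set.Icc (min 0 (α q.1 / nS q.1)) (max 0 (α q.1 / nS q.1)) := by
  unfold sourceLoss
  split_ifs
  exacts [⟨min_le_right _ _, le_max_right _ _⟩, ⟨min_le_left _ _, le_max_left _ _⟩]

lemma empLoss_sourceLoss (s : SourceSample 𝒳 nS) (h : 𝒳 → Bool) :
    empLoss (sourceLoss S nS α) s h = weightedEmpError S nS α s h := by
  simp only [empLoss, Fintype.sum_sigma, weightedEmpError, empError, sourceLoss, Finset.mul_sum,
    mul_ite, mul_one, mul_zero, mul_one_div]

lemma integral_sourceLoss (q : (i : Fin N) × Fin (nS i)) {h : 𝒳 → Bool} (hh : Measurable h) :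
    ∫ x, sourceLoss S nS α q (x, h x) ∂(S q.1).μ = α q.1 / nS q.1 * (S q.1).error h := by
  have h_ind : (fun x => sourceLoss S nS α q (x, h x)) =
      {x | h x ≠ (S q.1).label x}.indicator fun _ => α q.1 / nS q.1 := by
    ext x
    simp only [sourceLoss, Set.indicator_apply, Set.mem_ofPred_eq]
  rw [h_ind, integral_indicator_const _ (measurableSet_ne hh (S q.1).measurable_label),
    smul_eq_mul, mul_comm, LabeledDomain.error]

lemma sum_sq_sourceLoss_range (hnS : ∀ i, 0 < nS i) :
    ∑ q : (i : Fin N) × Fin (nS i), (max 0 (α q.1 / nS q.1) - min 0 (α q.1 / nS q.1)) ^ 2 =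
      ∑ i, α i ^ 2 / nS i := by
  simp only [max_sub_min_eq_abs, sub_zero, sq_abs, Fintype.sum_sigma, Finset.sum_const,
    Finset.card_univ, Fintype.card_fin, nsmul_eq_mul]
  refine Finset.sum_congr rfl fun i _ => ?_
  have := (hnS i).ne'
  field_simp

variable {nS α}

lemma expLoss_sourceLoss (hnS : ∀ i, 0 < nS i) {h : 𝒳 → Bool} (hh : Measurable h) :
    expLoss (fun q => (S q.1).μ) (sourceLoss S nS α) h = ∑ i, α i * (S i).error h := by
  simp only [expLoss, integral_sourceLoss S nS α _ hh, Fintype.sum_sigma, Finset.sum_const,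
    Finset.card_univ, Fintype.card_fin, nsmul_eq_mul]
  refine Finset.sum_congr rfl fun i _ => ?_
  have := (hnS i).ne'
  field_simp

end Sources

section DeviationTerm

variable {N : ℕ} {nS : Fin N → ℕ} {α β : Fin N → ℝ} {d m : ℕ} {δ : ℝ}

lemma sum_sq_div_pos (hnS : ∀ i, 0 < nS i) (hα : α ≠ 0) : 0 < ∑ i, α i ^ 2 / nS i := by
  obtain ⟨i, hi⟩ := Function.ne_iff.1 hα
  refine Finset.sum_pos' (fun i _ => by positivity) ⟨i, Finset.mem_univ _, ?_⟩
  have : (0 : ℝ) < nS i := by exact_mod_cast hnS i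
  have : α i ≠ 0 := hi
  positivity

lemma sum_sampleSize_pos (hnS : ∀ i, 0 < nS i) (hα : α ≠ 0) : 0 < ∑ i, nS i :=
  let ⟨i, _⟩ := Function.ne_iff.1 hα
  Finset.sum_pos (fun i _ => hnS i) ⟨i, Finset.mem_univ i⟩

lemma mul_log_div_add_one_nonneg {M : ℕ} (h : d ≤ M) :
    0 ≤ (d : ℝ) * (Real.log (M / d) + 1) := by
  rcases d.eq_zero_or_pos with rfl | hd
  · simp
  have h1 : (1 : ℝ) ≤ M / d := by
    rw [one_le_div (by exact_mod_cast hd)]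
    exact_mod_cast h
  have := Real.log_nonneg h1
  positivity

lemma deviationTerm_nonneg : 0 ≤ deviationTerm d α β m δ := by
  unfold deviationTerm
  positivity

lemma sq_deviationTerm_div_four (hm : 0 < m) (hdm : d ≤ 2 * m) (hβ : ∀ i, β i = (nS i : ℝ) / m)
    (hδ : 0 < δ) (hδ1 : δ ≤ 1) :
    (deviationTerm d α β m δ / 4) ^ 2 = 2 * (∑ i, α i ^ 2 / nS i) *
      (d * (Real.log ((2 * m : ℕ) / d) + 1) + Real.log (4 / δ)) := by
  have : (0 : ℝ) < m := by exact_mod_cast hm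
  have h_sum : ∑ i, α i ^ 2 / β i = m * ∑ i, α i ^ 2 / nS i := by
    rw [Finset.mul_sum]
    refine Finset.sum_congr rfl fun i _ => ?_
    rw [hβ, div_div_eq_mul_div]
    ring
  have h_log : 0 ≤ Real.log (4 / δ) := Real.log_nonneg (by rw [one_le_div hδ]; linarith)
  have h_complexity := mul_log_div_add_one_nonneg hdm
  have h_arg : (∑ i, α i ^ 2 / β i) *
      ((2 * d * (Real.log (2 * m / d) + 1) + 2 * Real.log (4 / δ)) / m) =
      2 * (∑ i, α i ^ 2 / nS i) *
        (d * (Real.log ((2 * m : ℕ) / d) + 1) + Real.log (4 / δ)) := by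
    rw [h_sum]
    push_cast
    field_simp
  rw [deviationTerm, mul_div_cancel_left₀ _ four_ne_zero, h_arg, Real.sq_sqrt]
  exact mul_nonneg (mul_nonneg two_pos.le (Finset.sum_nonneg fun i _ => by positivity))
    (add_nonneg h_complexity h_log)

end DeviationTerm

section UniformDeviation

variable {𝒳 : Type*} [MeasurableSpace 𝒳] {N : ℕ} (S : Fin N → LabeledDomain 𝒳)
  {nS : Fin N → ℕ} {α β : Fin N → ℝ} {d m : ℕ} {δ : ℝ}

instance : IsProbabilityMeasure (sampleLaw S nS) :=
  inferInstanceAs (IsProbabilityMeasure (Measure.pi fun q : (i : Fin N) × Fin (nS i) => (S q.1).μ))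

theorem sampleLaw_exists_lt_sub_weightedEmpError_le {H : Set (𝒳 → Bool)}
    (hH : IsMeasurableClass H) (hd : classVCDim H ≤ d) (hα : α ≠ 0) (hnS : ∀ i, 0 < nS i)
    (hm : m = ∑ i, nS i) (hdm : d ≤ 2 * m) (hβ : ∀ i, β i = (nS i : ℝ) / m)
    (hδ : 0 < δ) (hδ1 : δ ≤ 1) :
    sampleLaw S nS {s | ∃ h ∈ H, deviationTerm d α β m δ / 2 <
        ∑ i, α i * (S i).error h - weightedEmpError S nS α s h} ≤ ENNReal.ofReal (δ / 2) := by
  have hm0 : 0 < m := hm ▸ sum_sampleSize_pos hnS hα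
  set L : ℝ := d * (Real.log ((2 * m : ℕ) / d) + 1)
  have h_range := sum_sq_sourceLoss_range nS α hnS
  have h_range_pos := sum_sq_div_pos hnS hα
  have h_trace (x : ((i : Fin N) × Fin (nS i)) ⊕ ((i : Fin N) × Fin (nS i)) → 𝒳) :
      (classTrace H x).card ≤ ∑ k ∈ Finset.range (d + 1), (2 * m).choose k := by
    simpa [hm, two_mul] using card_classTrace_le_sum_choose hd x
  have h_growth : ((∑ k ∈ Finset.range (d + 1), (2 * m).choose k : ℕ) : ℝ) ≤ Real.exp L := by
    exact_mod_cast sum_range_choose_le_exp hdm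
  have h_exponent : -(deviationTerm d α β m δ / 4) ^ 2 / (2 * ∑ i, α i ^ 2 / nS i) =
      -L + -Real.log (4 / δ) := by
    rw [sq_deviationTerm_div_four hm0 hdm hβ hδ hδ1]
    field_simp
    ring
  have h_vc := measure_exists_expLoss_sub_empLoss_gt_le (fun q => (S q.1).μ) hH h_trace
    (measurable_sourceLoss S nS α) (sourceLoss_mem_Icc S nS α) (by rwa [h_range])
    (u := deviationTerm d α β m δ / 4) (div_nonneg deviationTerm_nonneg (by norm_num))
  rw [h_range, h_exponent, Real.exp_add, Real.exp_neg (Real.log _), Real.exp_log (by positivity),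
    inv_div] at h_vc
  refine (measure_mono ?_).trans (h_vc.trans (ENNReal.ofReal_le_ofReal ?_))
  · rintro s ⟨h, hh, hs⟩
    refine ⟨h, hh, ?_⟩
    rw [expLoss_sourceLoss S hnS (hH.measurable h hh), empLoss_sourceLoss]
    linarith
  · have h_cancel :
        ((∑ k ∈ Finset.range (d + 1), (2 * m).choose k : ℕ) : ℝ) * Real.exp (-L) ≤ 1 := by
      rwa [Real.exp_neg, ← div_eq_mul_inv, div_le_one (Real.exp_pos _)]
    nlinarith

theorem sampleLaw_le_weightedEmpError_sub_le (hα : α ≠ 0) (hnS : ∀ i, 0 < nS i) (hm0 : 0 < m)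
    (hdm : d ≤ 2 * m) (hβ : ∀ i, β i = (nS i : ℝ) / m) {h : 𝒳 → Bool} (hh : Measurable h)
    (hδ : 0 < δ) (hδ1 : δ ≤ 1) :
    sampleLaw S nS {s | deviationTerm d α β m δ / 2 ≤
        weightedEmpError S nS α s h - ∑ i, α i * (S i).error h} ≤ ENNReal.ofReal (δ / 2) := by
  have h_range_pos := sum_sq_div_pos hnS hα
  have h_log : 0 ≤ Real.log (4 / δ) := Real.log_nonneg (by rw [one_le_div hδ]; linarith)
  have h_complexity := mul_log_div_add_one_nonneg hdm
  have h_exponent : -(2 * (deviationTerm d α β m δ / 2) ^ 2) / ∑ i, α i ^ 2 / nS i ≤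
      -Real.log (4 / δ) := by
    have h_sq := sq_deviationTerm_div_four (α := α) hm0 hdm hβ hδ hδ1
    rw [div_le_iff₀ h_range_pos]
    nlinarith [mul_nonneg h_range_pos.le h_complexity, mul_nonneg h_range_pos.le h_log]
  have h_hoeffding := measureReal_pi_sum_sub_integral_ge_le (fun q => (S q.1).μ)
    (f := fun q x => sourceLoss S nS α q (x, h x))
    (fun q => (measurable_sourceLoss S nS α q).comp (measurable_id.prodMk hh))
    (fun q x => sourceLoss_mem_Icc S nS α q (x, h x))
    (u := deviationTerm d α β m δ / 2) (div_nonneg deviationTerm_nonneg two_pos.le)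
  rw [sum_sq_sourceLoss_range nS α hnS] at h_hoeffding
  have h_sum (s : SourceSample 𝒳 nS) :
      weightedEmpError S nS α s h - ∑ i, α i * (S i).error h =
        ∑ q, (sourceLoss S nS α q (s q, h (s q)) -
          ∫ x, sourceLoss S nS α q (x, h x) ∂(S q.1).μ) := by
    rw [← empLoss_sourceLoss, ← expLoss_sourceLoss S hnS hh, empLoss, expLoss,
      Finset.sum_sub_distrib]
  simp only [h_sum]
  rw [← ofReal_measureReal]
  refine ENNReal.ofReal_le_ofReal (h_hoeffding.trans ((Real.exp_le_exp.2 h_exponent).trans ?_))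
  rw [Real.exp_neg, Real.exp_log (by positivity), inv_div]
  linarith

lemma exists_measurableSet_subset_compl_union {Ω : Type*} [MeasurableSpace Ω] (P : Measure Ω)
    [IsProbabilityMeasure P] {A B : Set Ω} (hδ : 0 ≤ δ) (hA : P A ≤ ENNReal.ofReal (δ / 2))
    (hB : P B ≤ ENNReal.ofReal (δ / 2)) :
    ∃ G ⊆ (A ∪ B)ᶜ, MeasurableSet G ∧ ENNReal.ofReal (1 - δ) ≤ P G := by
  refine ⟨(toMeasurable P (A ∪ B))ᶜ, Set.compl_subset_compl.2 (subset_toMeasurable _ _),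
    (measurableSet_toMeasurable _ _).compl, ?_⟩
  rw [prob_compl_eq_one_sub (measurableSet_toMeasurable _ _), measure_toMeasurable,
    ENNReal.ofReal_sub _ hδ, ENNReal.ofReal_one]
  refine tsub_le_tsub_left ((measure_union_le _ _).trans ((add_le_add hA hB).trans_eq ?_)) _
  rw [← ENNReal.ofReal_add (by positivity) (by positivity), add_halves]

end UniformDeviation

section EmpiricalRiskMinimization

variable {𝒳 : Type*} [MeasurableSpace 𝒳] {N : ℕ} {S : Fin N → LabeledDomain 𝒳}
  {T : LabeledDomain 𝒳} {α b : Fin N → ℝ}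

lemma abs_sum_mul_error_sub_error_le (hα : ∀ i, 0 ≤ α i) (hα1 : ∑ i, α i = 1) {h : 𝒳 → Bool}
    (hb : ∀ i, |(S i).error h - T.error h| ≤ b i) :
    |∑ i, α i * (S i).error h - T.error h| ≤ ∑ i, α i * b i :=
  calc |∑ i, α i * (S i).error h - T.error h|
      = |∑ i, α i * ((S i).error h - T.error h)| := by
        simp only [mul_sub, Finset.sum_sub_distrib, ← Finset.sum_mul, hα1, one_mul]
    _ ≤ ∑ i, |α i * ((S i).error h - T.error h)| := Finset.abs_sum_le_sum_abs _ _
    _ ≤ ∑ i, α i * b i := Finset.sum_le_sum fun i _ => by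
        rw [abs_mul, abs_of_nonneg (hα i)]
        exact mul_le_mul_of_nonneg_left (hb i) (hα i)

theorem IsEmpMinimizer.error_le {nS : Fin N → ℕ} {H : Set (𝒳 → Bool)} {s : SourceSample 𝒳 nS}
    {hhat h₀ : 𝒳 → Bool} (hmin : IsEmpMinimizer S nS α H s hhat) (hh₀ : h₀ ∈ H)
    (hα : ∀ i, 0 ≤ α i) (hα1 : ∑ i, α i = 1)
    (hb : ∀ h ∈ H, ∀ i, |(S i).error h - T.error h| ≤ b i) {t : ℝ}
    (hhat_dev : ∑ i, α i * (S i).error hhat - weightedEmpError S nS α s hhat ≤ t)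
    (hh₀_dev : weightedEmpError S nS α s h₀ - ∑ i, α i * (S i).error h₀ ≤ t) :
    T.error hhat ≤ T.error h₀ + 2 * t + 2 * ∑ i, α i * b i := by
  have hhat_cmp := (abs_le.1 (abs_sum_mul_error_sub_error_le hα hα1 (hb hhat hmin.1))).1
  have hh₀_cmp := (abs_le.1 (abs_sum_mul_error_sub_error_le hα hα1 (hb h₀ hh₀))).2
  linarith [hmin.2 h₀ hh₀]

end EmpiricalRiskMinimization

theorem theorem1_general {n : ℕ} {X : Set (Fin n → ℝ)} (hX : IsCompact X) (ρ : Measure X)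
    [IsFiniteMeasure ρ] {H : Set (X → Bool)} (hH : IsMeasurableClass H) {d : ℕ}
    (hd : classVCDim H ≤ d) {ε : ℝ} (hε : 0 < ε) :
    ∃ (k : ℕ) (a : ℝ), ∀ {N : ℕ} (S : Fin N → LabeledDomain X) (T : LabeledDomain X),
      (∀ i, (S i).μ + T.μ ≤ ρ) → ∀ {α : Fin N → ℝ}, (∀ i, 0 ≤ α i) → ∑ i, α i = 1 →
      ∀ {nS : Fin N → ℕ}, (∀ i, 0 < nS i) → ∀ {m : ℕ}, m = ∑ i, nS i → d ≤ 2 * m →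
      ∀ {β : Fin N → ℝ}, (∀ i, β i = (nS i : ℝ) / m) → ∀ h₀ ∈ H, ∀ {δ : ℝ}, 0 < δ → δ ≤ 1 →
        ∃ G : Set (SourceSample X nS), MeasurableSet G ∧
          ENNReal.ofReal (1 - δ) ≤ sampleLaw S nS G ∧
          ∀ s ∈ G, ∀ hhat : X → Bool, IsEmpMinimizer S nS α H s hhat →
            T.error hhat ≤ T.error h₀ + deviationTerm d α β m δ + ε +
              ∑ i, α i * (2 * jointError H (S i) T +
                a * ∑ j ∈ Finset.Icc 1 k, labelMomentDiv j (S i) T) := by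
  have := isCompact_iff_compactSpace.1 hX
  obtain ⟨k, a, hcmp⟩ := exists_abs_error_sub_error_le ρ hH.measurable hd (half_pos hε)
  refine ⟨k, 2 * a, fun {N} S T hρ α hα hα1 nS hnS m hm hdm β hβ h₀ hh₀ δ hδ hδ1 => ?_⟩
  have hα0 : α ≠ 0 := by rintro rfl; simp at hα1
  obtain ⟨G, hGsub, hG, hGδ⟩ := exists_measurableSet_subset_compl_union (sampleLaw S nS) hδ.le
    (sampleLaw_exists_lt_sub_weightedEmpError_le S hH hd hα0 hnS hm hdm hβ hδ hδ1)
    (sampleLaw_le_weightedEmpError_sub_le S hα0 hnS (hm ▸ sum_sampleSize_pos hnS hα0) hdm hβ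
      (hH.measurable h₀ hh₀) hδ hδ1)
  refine ⟨G, hG, hGδ, fun s hs hhat hmin => ?_⟩
  have hdev := hGsub hs
  rw [Set.mem_compl_iff, Set.mem_union, not_or] at hdev
  have hle := hmin.error_le hh₀ hα hα1 (fun h hh i => hcmp (S i) T (hρ i) h hh)
    (not_lt.1 fun hlt => hdev.1 ⟨hhat, hmin.1, hlt⟩) (not_le.1 hdev.2).le
  have hsum : 2 * ∑ i, α i * (jointError H (S i) T + ε / 2 +
      a * ∑ j ∈ Finset.Icc 1 k, labelMomentDiv j (S i) T) =
      ε + ∑ i, α i * (2 * jointError H (S i) T +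
        2 * a * ∑ j ∈ Finset.Icc 1 k, labelMomentDiv j (S i) T) := by
    nth_rw 2 [← one_mul ε]
    rw [← hα1, Finset.sum_mul, ← Finset.sum_add_distrib, Finset.mul_sum]
    exact Finset.sum_congr rfl fun i _ => by ring
  linarith

theorem theorem1 {n : ℕ} {X : Set (Fin n → ℝ)} (hX : IsCompact X)
    {N : ℕ} (S : Fin N → LabeledDomain X) (T : LabeledDomain X)
    (H : Set (X → Bool)) (hH : IsMeasurableClass H) (d : ℕ) (hd : classVCDim H = d)
    (α : Fin N → ℝ) (hα : ∀ i, 0 ≤ α i) (hα1 : ∑ i, α i = 1)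
    (nS : Fin N → ℕ) (hnS : ∀ i, 0 < nS i)
    (m : ℕ) (hm : m = ∑ i, nS i) (hdm : d ≤ 2 * m)
    (β : Fin N → ℝ) (hβ : ∀ i, β i = (nS i : ℝ) / m)
    (hT : X → Bool) (hTmem : hT ∈ H) (hTmin : ∀ h ∈ H, T.error hT ≤ T.error h) :
    ∀ δ : ℝ, 0 < δ → δ < 1 → ∀ ε : ℝ, 0 < ε →
      ∃ (nε : Fin N → ℕ) (a : Fin N → ℝ),
        ∃ G : Set (SourceSample X nS), MeasurableSet G ∧
          ENNReal.ofReal (1 - δ) ≤ sampleLaw S nS G ∧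
          ∀ s ∈ G, ∀ hhat : X → Bool, IsEmpMinimizer S nS α H s hhat →
            T.error hhat ≤ T.error hT + deviationTerm d α β m δ + ε +
              ∑ i, α i * (2 * jointError H (S i) T +
                a i * ∑ k ∈ Finset.Icc 1 (nε i), labelMomentDiv k (S i) T) := by
  intro δ hδ hδ1 ε hε
  have hρ (i : Fin N) : (S i).μ + T.μ ≤ ∑ j, ((S j).μ + T.μ) :=
    Finset.single_le_sum (f := fun j => (S j).μ + T.μ) (fun _ _ => Measure.zero_le _)
      (Finset.mem_univ i)
  obtain ⟨k, a, h⟩ := theorem1_general hX (∑ j, ((S j).μ + T.μ)) hH hd.le hε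
  exact ⟨fun _ => k, fun _ => a, h S T hρ hα hα1 hnS hm hdm hβ hT hTmem hδ hδ1.le⟩
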